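/- Let $k$ be a finite field of characteristic $3$, $K=k((t))$ with normalized valuation $v_K$, $\mathcal O_K=k[[t]]$, and let $\mu$ be a generator of $k^\times$. Let $$S=\begin{pmatrix}0&1&0\\0&0&1\\1&0&0\end{pmatrix},\qquad T=\begin{pmatrix}0&0&-1\\0&-1&0\\-1&0&0\end{pmatrix},$$ let $G\subset \mathrm{SL}_3(k)$ be a subgroup and $V$ its natural representation, over $\mathcal O_K$. Let $A$ be a $G$-étale $K$-algebra, that is, a finite étale $K$-algebra of degree $\#G$ with a right action of $G$ by $K$-algebra automorphisms such that $A^G=K$, and let $\mathcal O_A$ be the integral closure of $\mathcal O_K$ in $A$. Let $M=\bigoplus_{i=1}^3\mathcal O_Kx_i$ be the linear part of the coordinate ring of $V$, with its right $G$-action, put $\Xi=\mathrm{Hom}^G_{\mathcal O_K}(M,\mathcal O_A)$ and $$v_V(A)=\frac1{\#G}\,\mathrm{length}_{\mathcal O_K}\frac{\mathrm{Hom}_{\mathcal O_K}(M,\mathcal O_A)}{\mathcal O_A\cdot\Xi}.$$ Suppose that a component (field factor) $L$ of $A$ has stabilizer $H_A=\langle S,T\rangle\cong\mathfrak S_3$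 in $G$, so that $L/K$ is Galois with group $H_A$, acting on the right. Let $Q=L^{S}$ be the fixed field of $S$, and suppose that $Q=K(\alpha)$ with $\alpha^2\in\{\mu,\ t,\ \mu t\}$ and $\alpha\cdot T=-\alpha$. Let $k_Q$ be the residue field of $Q$ (identified with the algebraic closure of $k$ in $Q$), $\pi_Q$ a uniformizer of $Q$, $\lambda\in k_Q$ an element not of the form $\kappa^3-\kappa$ with $\kappa\in k_Q$, and suppose that $L=Q(\beta)$ with $$\beta^3-\beta\in\mathbb F_3\lambda\oplus\bigoplus_{j>0,\ 3\nmid j}k_Q\,\pi_Q^{-j},\qquad \beta\cdot S=\beta+1,\qquad \beta\cdot T=-\beta.$$ Let $v_L$ be the normalized valuation of $L$ and $e_{L/K}$ the ramification index of $L/K$. Then $e_{L/K}=3$ if $\alpha^2=\mu$ and $e_{L/K}=6$ otherwise, the length above is finite, and $$v_V(A)=v_K(\alpha^2)+\left\lceil\frac{-v_L(\beta)}{e_{L/K}}\right\rceil+\left\lceil\frac{-2v_L(\beta)-v_L(\alpha)}{e_{L/K}}\right\rceil .$$ -/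

import Mathlib

open scoped LaurentSeries PowerSeries RightActions IntermediateField Matrix

noncomputable section

namespace WildMcKay

/-! `K = k⸨X⸩` with ring of integers `k⟦X⟧`; groups act on the right, `a <• g`. -/

/-- The length over `R` of the quotient of `Hom_R(M, B)` by its `B`-submodule `B · N` generated by
`N`. -/
def spanColength (R M B : Type*) [CommRing R] [AddCommGroup M] [Module R M] [CommRing B]
    [Algebra R B] (N : Submodule R (M →ₗ[R] B)) : ℕ∞ :=
  Module.length R ((M →ₗ[R] B) ⧸ Submodule.span B (N : Set (M →ₗ[R] B)))

section EtaleAlgebras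

variable (k : Type*) [Field k] (G : Type*) [Group G]
  (A : Type*) [CommRing A] [Algebra k⸨X⸩ A] [Algebra k⟦X⟧ A]
  [IsScalarTower k⟦X⟧ k⸨X⸩ A] [MulSemiringAction Gᵐᵒᵖ A] [SMulCommClass Gᵐᵒᵖ k⸨X⸩ A]

/-- `A` is a `G`-étale algebra over `K = k⸨X⸩`: a finite étale `K`-algebra of degree `#G` on which
`G` acts (on the right, by `K`-algebra automorphisms) with `A ^ G = K`. -/
structure IsGEtale : Prop where
  finite : Module.Finite k⸨X⸩ A
  etale : Algebra.Etale k⸨X⸩ A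
  finrank_eq : Module.finrank k⸨X⸩ A = Nat.card G
  fixed : ∀ a : A, (∀ g : G, a <• g = a) → a ∈ (algebraMap k⸨X⸩ A).range

variable {k G} {n : ℕ}

/-- The tuning module `Hom^G(M, 𝓞_A)`. Here `𝓞_A` is the integral closure of `k⟦X⟧` in `A`, and `M`
is the linear part of the coordinate ring of the representation `ρ` of `G` on affine `n`-space over
`k⟦X⟧`: it is free with basis the coordinates `x_1, …, x_n`, and `G` acts on it on the right by
substitution, `x_j · g = ∑ i, (ρ g) j i * x_i`. -/
def tuningModule (ρ : G →* Matrix (Fin n) (Fin n) k⟦X⟧) :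
    Submodule k⟦X⟧ ((Fin n → k⟦X⟧) →ₗ[k⟦X⟧] integralClosure k⟦X⟧ A) where
  carrier := {φ | ∀ (g : G) (m : Fin n → k⟦X⟧), (φ (m ᵥ* ρ g) : A) = (φ m : A) <• g}
  add_mem' := by
    intro φ ψ hφ hψ g m
    simp [hφ g m, hψ g m]
  zero_mem' := by
    intro g m
    simp
  smul_mem' := by
    intro c φ hφ g m
    have h : ∀ a : A, c • a = (algebraMap k⟦X⟧ k⸨X⸩ c) • a := fun a =>
      (algebraMap_smul k⸨X⸩ c a).symm
    simp only [LinearMap.smul_apply, Subalgebra.coe_smul, hφ g m, h]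
    exact (smul_comm _ _ _).symm

/-- The length over `k⟦X⟧` of `Hom(M, 𝓞_A) / (𝓞_A · Ξ)`, where `Ξ` is the tuning module. -/
def tuningColength (ρ : G →* Matrix (Fin n) (Fin n) k⟦X⟧) : ℕ∞ :=
  spanColength k⟦X⟧ (Fin n → k⟦X⟧) (integralClosure k⟦X⟧ A) (tuningModule A ρ)

/-- The `v`-function `v_V(A) = (1 / #G) * length (Hom(M, 𝓞_A) / (𝓞_A · Ξ))` (meaningful when that
length is finite). -/
def vFunction (ρ : G →* Matrix (Fin n) (Fin n) k⟦X⟧) : ℚ :=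
  (tuningColength A ρ).toNat / Nat.card G

end EtaleAlgebras

section Components

variable {k : Type*} [Field k] {G : Type*} [Group G]
  {A : Type*} [CommRing A] [Algebra k⸨X⸩ A]
  [MulSemiringAction Gᵐᵒᵖ A] [SMulCommClass Gᵐᵒᵖ k⸨X⸩ A]
  {L : Type*} [Field L] [Algebra k⸨X⸩ L]

/-- The stabilizer in `G` of the component `L` of `A`, given by the projection `pr : A → L`:
those `g` which preserve the kernel of the projection (the sum of the other components). -/
def componentStabilizer (pr : A →ₐ[k⸨X⸩] L) : Subgroup G where
  carrier := {g | ∀ a : A, pr (a <• g) = 0 ↔ pr a = 0}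
  one_mem' := by
    intro a
    simp
  mul_mem' := by
    intro g h hg hh a
    rw [MulOpposite.op_mul, mul_smul, hh, hg]
  inv_mem' := by
    intro g hg a
    have := hg (a <• g⁻¹)
    rw [MulOpposite.op_inv, smul_inv_smul] at this
    rw [MulOpposite.op_inv]
    exact this.symm

/-- The action of `h` in the stabilizer of the component `L` on `L`: the element `pr a` is sent to
`pr (a <• h)`. -/
def componentAct (pr : A →ₐ[k⸨X⸩] L) (hpr : Function.Surjective pr)
    (h : componentStabilizer (G := G) pr) : L →ₐ[k⸨X⸩] L :=
  AlgHom.liftOfSurjective pr hpr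
    (pr.comp (MulSemiringAction.toAlgHom k⸨X⸩ A (MulOpposite.op (h : G))))
    (fun a ha => (h.2 a).2 ha)

theorem componentAct_apply (pr : A →ₐ[k⸨X⸩] L) (hpr : Function.Surjective pr)
    (h : componentStabilizer (G := G) pr) (a : A) :
    componentAct pr hpr h (pr a) = pr (a <• (h : G)) :=
  AlgHom.liftOfSurjective_apply pr hpr _ _ a

end Components

section Valuations

instance isDedekindDomain_integers {k : Type*} [Field k] {L : Type*} [Field L] [Algebra k⸨X⸩ L]
    [Algebra k⟦X⟧ L] [IsScalarTower k⟦X⟧ k⸨X⸩ L] [FiniteDimensional k⸨X⸩ L]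
    [Algebra.IsSeparable k⸨X⸩ L] : IsDedekindDomain (integralClosure k⟦X⟧ L) :=
  integralClosure.isDedekindDomain k⟦X⟧ k⸨X⸩ L

instance isFractionRing_integers {k : Type*} [Field k] {L : Type*} [Field L] [Algebra k⸨X⸩ L]
    [Algebra k⟦X⟧ L] [IsScalarTower k⟦X⟧ k⸨X⸩ L] [FiniteDimensional k⸨X⸩ L] :
    IsFractionRing (integralClosure k⟦X⟧ L) L :=
  integralClosure.isFractionRing_of_finite_extension k⸨X⸩ L

/-- The additive normalized (`ℤ`-valued) valuation of `x ≠ 0` at a nonzero prime `P`. -/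
def ord {R : Type*} [CommRing R] [IsDedekindDomain R] {F : Type*} [Field F] [Algebra R F]
    [IsFractionRing R F] (P : IsDedekindDomain.HeightOneSpectrum R) (x : F) : ℤ :=
  -WithZero.log (P.valuation F x)

end Valuations

section ArtinSchreier

variable {k : Type*} [Field k] {L : Type*} [Field L] [Algebra k⸨X⸩ L]

/-- The residue field `k_Q` of the local field `Q`, regarded as a subfield of `Q`: it consists of
the elements of `Q` that are algebraic over `k`. -/
def residueConstants (Q : IntermediateField k⸨X⸩ L) : Set L :=
  {x | x ∈ Q ∧ ((algebraMap k⸨X⸩ L).comp HahnSeries.C).IsIntegralElem x}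

/-- The group `𝔽₃ lam ⊕ ⨁ k_Q π ^ (-j)`, the sum over the `j > 0` with `3 ∤ j`. -/
def artinSchreierReps (Q : IntermediateField k⸨X⸩ L) (lam π : L) : AddSubgroup L :=
  AddSubgroup.zmultiples lam ⊔
    AddSubgroup.closure
      {x | ∃ j : ℕ, 0 < j ∧ ¬ 3 ∣ j ∧ ∃ κ ∈ residueConstants Q, x = κ * π⁻¹ ^ j}

end ArtinSchreier

section Matrices

/-- The matrix `S`. -/
def matS (k : Type*) [Field k] : Matrix.SpecialLinearGroup (Fin 3) k :=
  ⟨!![0, 1, 0; 0, 0, 1; 1, 0, 0], by simp [Matrix.det_fin_three]⟩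

/-- The matrix `T`. -/
def matT (k : Type*) [Field k] : Matrix.SpecialLinearGroup (Fin 3) k :=
  ⟨!![0, 0, -1; 0, -1, 0; -1, 0, 0], by simp [Matrix.det_fin_three]⟩

/-- The natural representation of a subgroup of `SL_3(k)`, over `k⟦X⟧`. -/
def naturalRep {k : Type*} [Field k] (G : Subgroup (Matrix.SpecialLinearGroup (Fin 3) k)) :
    G →* Matrix (Fin 3) (Fin 3) k⟦X⟧ where
  toFun g := (g : Matrix.SpecialLinearGroup (Fin 3) k).1.map (PowerSeries.C (R := k))
  map_one' := by simp
  map_mul' g h := by simp [Matrix.map_mul]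

end Matrices

end WildMcKay

end

/-! Write `σ`, `τ` for the actions of `S`, `T` on `L`. A `G`-étale algebra is a product of copies of
`L` indexed by the cosets of the stabilizer, so the tuning module is the module of
stabilizer-equivariant maps `M → 𝓞_L`. `S` permutes the coordinates cyclically and `T` negates the
middle one. Such a map is therefore determined by the image `y` of the middle coordinate, and the
only condition on the integral element `y` is `τ y = -y` (`tuningModule_eq_orbitMap`,
`orbitMap_equivariant`, `exists_mem_tuningModule`).

The `-1`-eigenspace of `τ` on `L` has the `K`-generators `α`, `β`, `αβ²`. The class `β³ - β` cannot
be constant: the relation `τ β = -β` would make `lam` of the form `κ³ - κ`, or zero when `Q/K` is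
ramified. Hence it has a pole of order `j` in `π`, with `3 ∤ j`. Comparing orders and using `e f ≤
6` gives `e = 3` or `e = 6`, and `ord β = -j` (`exists_ramification_data`). The orders of `c₀ α`,
`c₁ β`, `c₂ αβ²` with coefficients in `K` are then `0`, `-j`, `-2j` modulo `3`, pairwise distinct.
No cancellation can occur, so a sum is integral only if each term is. The integral eigenspace is
thus spanned over `k⟦X⟧` by `α`, `t^n₁ β`, `t^n₂ αβ²`, where `n₁`, `n₂` are the two ceilings of the
formula (`exists_of_integral_anti_invariant`).

Finally, the determinant of three generators of the tuning module lies in `K` because `G ⊂ SL₃`, and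
the colength is `#G` times its order (`tuningColength_eq`). Here it is a Vandermonde determinant
equal to `-α² t^(n₁+n₂)` (`det_orbitMap`). -/

section Length

/-! ### Colength as the order of a determinant. -/

/-- Over a principal ideal domain, the length of the cokernel of an endomorphism of a finite free
module is the order of vanishing of its determinant. -/
theorem length_quotient_range_eq_ord_det {R M : Type*} [CommRing R] [IsDomain R]
    [IsPrincipalIdealRing R] [AddCommGroup M] [Module R M] [Module.Free R M] [Module.Finite R M]
    (f : M →ₗ[R] M) (hf : LinearMap.det f ≠ 0) :
    Module.length R (M ⧸ LinearMap.range f) = Ring.ord R (LinearMap.det f) := by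
  classical
  set N := LinearMap.range f with hN
  let b := Module.Free.chooseBasis R M
  have hker : LinearMap.ker f = ⊥ := by
    by_contra h
    exact hf (LinearMap.det_eq_zero_iff_ker_ne_bot.mpr h)
  have hinj : Function.Injective f := LinearMap.ker_eq_bot.mp hker
  let e : M ≃ₗ[R] N := LinearEquiv.ofInjective f hinj
  have h : Module.finrank R N = Module.finrank R M := e.symm.finrank_eq
  let a := Submodule.smithNormalFormCoeffs b h
  let b' := Submodule.smithNormalFormTopBasis b h
  let ab := Submodule.smithNormalFormBotBasis b h
  have ab_eq := Submodule.smithNormalFormBotBasis_def b h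
  -- `f` and `g` have the same image `N` and differ by an automorphism of `M`, so their determinants
  -- are associated; `g` is diagonal in the Smith basis.
  let e' : M ≃ₗ[R] N := b'.equiv ab (Equiv.refl _)
  let g : M →ₗ[R] M := N.subtype.comp (e' : M →ₗ[R] N)
  have hfe : f = N.subtype ∘ₗ (e : M →ₗ[R] N) := by ext; rfl
  have hassoc : Associated (LinearMap.det f) (LinearMap.det g) := by
    conv_lhs => rw [hfe]
    exact LinearMap.associated_det_comp_equiv _ _ _
  have ha : ∀ i, g (b' i) = a i • b' i := by
    intro i
    have : g (b' i) = b'.equiv ab (Equiv.refl _) (b' i) := rfl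
    rw [this, b'.equiv_apply, Equiv.refl_apply]
    exact ab_eq i
  have hdet : LinearMap.det g = ∏ i, a i := by
    rw [← LinearMap.det_toMatrix b', ← Matrix.det_diagonal]
    congr 1
    ext i j
    rw [LinearMap.toMatrix_apply, ha, map_smul, Module.Basis.repr_self, Finsupp.smul_single,
      smul_eq_mul, mul_one]
    by_cases h : i = j
    · rw [h, Matrix.diagonal_apply_eq, Finsupp.single_eq_same]
    · rw [Matrix.diagonal_apply_ne _ h, Finsupp.single_eq_of_ne h]
  have hprod : ∀ s : Finset (Module.Free.ChooseBasisIndex R M), (∏ i ∈ s, a i) ≠ 0 →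
      Ring.ord R (∏ i ∈ s, a i) = ∑ i ∈ s, Ring.ord R (a i) := by
    intro s
    induction s using Finset.induction_on with
    | empty => simp
    | insert i s hi ih =>
      intro hne
      rw [Finset.prod_insert hi] at hne ⊢
      rw [Finset.sum_insert hi, ← ih (right_ne_zero_of_mul hne),
        Ring.ord_mul _ (mem_nonZeroDivisors_of_ne_zero (right_ne_zero_of_mul hne))]
  rw [Ring.ord_eq_of_associated hassoc, hdet, hprod _ (by
      rw [← hdet]; exact fun h0 => hf (hassoc.eq_zero_iff.mpr h0)),
    (N.quotientEquivPiSpan b h).length_eq, Module.length_pi_of_fintype]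
  rfl

/-- If the determinant of a square matrix `D` over a finite free `R`-algebra `B` is an element `r`
of `R`, then the quotient of `B ^ n` by the span of the rows of `D` has `R`-length
`rank_R B * ord r`. -/
theorem length_quotient_span_rows {R B ι : Type*} [CommRing R] [IsDomain R]
    [IsPrincipalIdealRing R] [CommRing B] [Algebra R B] [Module.Free R B] [Module.Finite R B]
    [Fintype ι] [DecidableEq ι] (D : Matrix ι ι B) {r : R} (hr : r ≠ 0)
    (hD : D.det = algebraMap R B r) :
    Module.length R ((ι → B) ⧸ Submodule.span B (Set.range D.row)) =
      Module.finrank R B * Ring.ord R r := by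
  -- The `R`-determinant of a `B`-linear map is the norm of its `B`-determinant, and the norm of a
  -- scalar `r` is `r ^ rank`.
  have hdet : LinearMap.det (D.vecMulLinear.restrictScalars R) = r ^ Module.finrank R B := by
    rw [LinearMap.det_restrictScalars]
    have : D.vecMulLinear = Matrix.toLin' Dᵀ := by
      ext; simp
    rw [this, LinearMap.det_toLin', Matrix.det_transpose, hD,
      Algebra.norm_algebraMap_of_basis (Module.Free.chooseBasis R B),
      Module.finrank_eq_card_chooseBasisIndex]
  have h := length_quotient_range_eq_ord_det (D.vecMulLinear.restrictScalars R)
    (by rw [hdet]; exact pow_ne_zero _ hr)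
  rw [hdet, Ring.ord_pow (mem_nonZeroDivisors_of_ne_zero hr), nsmul_eq_mul] at h
  rw [← h, ← range_vecMulLinear]
  rfl

end Length

namespace WildMcKay

/-! ### Decomposition of a `G`-étale algebra into copies of one component. -/

section Component

variable {k : Type*} [Field k] {G : Type*} [Group G]
  {A : Type*} [CommRing A] [Algebra k⸨X⸩ A]
  [MulSemiringAction Gᵐᵒᵖ A] {L : Type*} [Field L] [Algebra k⸨X⸩ L]

/-- An element of a `G`-étale algebra all of whose conjugates vanish on one component is zero. -/
theorem IsGEtale.eq_zero_of_forall [Finite G] (hA : IsGEtale k G A) (pr : A →ₐ[k⸨X⸩] L)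
    {a : A} (h : ∀ g : G, pr (a <• g) = 0) : a = 0 := by
  classical
  have : Finite Gᵐᵒᵖ := Finite.of_equiv G MulOpposite.opEquiv
  have : Fintype Gᵐᵒᵖ := Fintype.ofFinite _
  have := hA.etale
  have : IsReduced A := Algebra.FormallyUnramified.isReduced_of_field k⸨X⸩ A
  have hmap : (MulSemiringAction.charpoly Gᵐᵒᵖ a).map (pr : A →+* L) =
      Polynomial.X ^ Fintype.card Gᵐᵒᵖ := by
    have h' : ∀ g : Gᵐᵒᵖ, pr (g • a) = 0 := fun g => h g.unop
    simp [MulSemiringAction.charpoly_eq, Polynomial.map_prod, h']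
  -- The coefficients lie in `A ^ G = K`, which injects into `L`, so the identity in `L[X]` already
  -- holds in `A[X]`. Hence `a` is nilpotent, and `A` is reduced.
  have hX : MulSemiringAction.charpoly Gᵐᵒᵖ a = Polynomial.X ^ Fintype.card Gᵐᵒᵖ := by
    ext n
    obtain ⟨z, hz⟩ := hA.fixed ((MulSemiringAction.charpoly Gᵐᵒᵖ a).coeff n)
      (fun g => MulSemiringAction.smul_coeff_charpoly a n _)
    obtain ⟨w, hw⟩ : ∃ w, algebraMap k⸨X⸩ A w =
        (Polynomial.X ^ Fintype.card Gᵐᵒᵖ : Polynomial A).coeff n := by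
      rw [Polynomial.coeff_X_pow]
      split_ifs
      · exact ⟨1, map_one _⟩
      · exact ⟨0, map_zero _⟩
    have h1 := congrArg (fun p => p.coeff n) hmap
    simp only [Polynomial.coeff_map, ← hz] at h1
    rw [← Polynomial.map_X (pr : A →+* L), ← Polynomial.map_pow, Polynomial.coeff_map, ← hw] at h1
    simp only [RingHom.coe_coe, AlgHom.commutes] at h1
    rw [← hz, ← hw, (algebraMap k⸨X⸩ L).injective h1]
  have := MulSemiringAction.eval_charpoly Gᵐᵒᵖ a
  rw [hX, Polynomial.eval_pow, Polynomial.eval_X] at this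
  exact eq_zero_of_pow_eq_zero this

variable [SMulCommClass Gᵐᵒᵖ k⸨X⸩ A]

theorem componentAct_mul (pr : A →ₐ[k⸨X⸩] L) (hpr : Function.Surjective pr)
    (g h : componentStabilizer (G := G) pr) (x : L) :
    componentAct pr hpr (g * h) x = componentAct pr hpr h (componentAct pr hpr g x) := by
  obtain ⟨a, rfl⟩ := hpr x
  simp [componentAct_apply, mul_smul]

theorem componentAct_one (pr : A →ₐ[k⸨X⸩] L) (hpr : Function.Surjective pr) (x : L) :
    componentAct (G := G) pr hpr 1 x = x := by
  obtain ⟨a, rfl⟩ := hpr x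
  simp [componentAct_apply]

/-- A `G`-étale algebra is the product of copies of any of its components, indexed by the cosets of
the stabilizer of the component. -/
noncomputable def componentsHom (pr : A →ₐ[k⸨X⸩] L) :
    A →ₐ[k⸨X⸩] (G ⧸ componentStabilizer (G := G) pr → L) :=
  AlgHom.pi fun c => pr.comp (MulSemiringAction.toAlgHom k⸨X⸩ A (MulOpposite.op c.out))

theorem componentsHom_apply (pr : A →ₐ[k⸨X⸩] L) (a : A)
    (c : G ⧸ componentStabilizer (G := G) pr) : componentsHom pr a c = pr (a <• c.out) := rfl

theorem exists_smul_out (pr : A →ₐ[k⸨X⸩] L) (hpr : Function.Surjective pr) (g : G) :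
    ∃ h : componentStabilizer (G := G) pr,
      (QuotientGroup.mk g : G ⧸ componentStabilizer (G := G) pr).out = g * h ∧
      ∀ a, componentsHom (G := G) pr a (QuotientGroup.mk g) =
        componentAct pr hpr h (pr (a <• g)) := by
  obtain ⟨h, hh⟩ := QuotientGroup.mk_out_eq_mul (componentStabilizer (G := G) pr) g
  refine ⟨h, hh, fun a => ?_⟩
  rw [componentsHom_apply, hh, componentAct_apply, MulOpposite.op_mul, mul_smul]

/-- The chosen representative of the coset of `g` differs from `g` by an element of the stabilizer,
which acts injectively on `L`. Vanishing at the representatives thus forces vanishing at every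
conjugate. -/
theorem componentsHom_injective [Finite G] (hA : IsGEtale k G A) (pr : A →ₐ[k⸨X⸩] L)
    (hpr : Function.Surjective pr) : Function.Injective (componentsHom (G := G) pr) := by
  rw [injective_iff_map_eq_zero]
  intro a ha
  refine hA.eq_zero_of_forall pr fun g => ?_
  obtain ⟨h, -, hh⟩ := exists_smul_out (G := G) pr hpr g
  have := hh a
  rw [ha, Pi.zero_apply] at this
  exact (map_eq_zero _).mp this.symm

theorem card_quotient_mul_finrank [Finite G] [FiniteDimensional k⸨X⸩ L] (hA : IsGEtale k G A)
    (pr : A →ₐ[k⸨X⸩] L) (hpr : Function.Surjective pr)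
    (hL : Module.finrank k⸨X⸩ L ≤ Nat.card (componentStabilizer (G := G) pr)) :
    Nat.card (G ⧸ componentStabilizer (G := G) pr) * Module.finrank k⸨X⸩ L = Nat.card G := by
  have : Fintype (G ⧸ componentStabilizer (G := G) pr) := Fintype.ofFinite _
  -- One inequality is the assumed bound on `[L : K]`; the other is injectivity into a product of
  -- copies of `L`, together with `dim A = #G`.
  apply le_antisymm
  · rw [Subgroup.card_eq_card_quotient_mul_card_subgroup (componentStabilizer (G := G) pr)]
    exact Nat.mul_le_mul_left _ hL
  · rw [← hA.finrank_eq]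
    have h1 := LinearMap.finrank_le_finrank_of_injective
      (f := (componentsHom (G := G) pr).toLinearMap) (componentsHom_injective hA pr hpr)
    rwa [Module.finrank_pi_fintype, Finset.sum_const, Finset.card_univ, smul_eq_mul,
      ← Nat.card_eq_fintype_card] at h1

theorem componentsHom_bijective [Finite G] [FiniteDimensional k⸨X⸩ L] (hA : IsGEtale k G A)
    (pr : A →ₐ[k⸨X⸩] L) (hpr : Function.Surjective pr)
    (hL : Module.finrank k⸨X⸩ L ≤ Nat.card (componentStabilizer (G := G) pr)) :
    Function.Bijective (componentsHom (G := G) pr) := by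
  have : Fintype (G ⧸ componentStabilizer (G := G) pr) := Fintype.ofFinite _
  have := hA.finite
  refine ⟨componentsHom_injective hA pr hpr, ?_⟩
  have := (LinearMap.injective_iff_surjective_of_finrank_eq_finrank
    (f := (componentsHom (G := G) pr).toLinearMap) (by
      rw [Module.finrank_pi_fintype, Finset.sum_const, Finset.card_univ, smul_eq_mul,
        ← Nat.card_eq_fintype_card, card_quotient_mul_finrank hA pr hpr hL, hA.finrank_eq])).mp
      (componentsHom_injective hA pr hpr)
  exact this

end Component

theorem isIntegral_pi_iff {R ι : Type*} [CommRing R] [Finite ι] {S : ι → Type*}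
    [∀ i, CommRing (S i)] [∀ i, Algebra R (S i)] {x : ∀ i, S i} :
    IsIntegral R x ↔ ∀ i, IsIntegral R (x i) := by
  constructor
  · exact fun h i => h.map (Pi.evalAlgHom R S i)
  · intro h
    have : Fintype ι := Fintype.ofFinite ι
    choose p hp hpx using h
    refine ⟨∏ i, p i, Polynomial.monic_prod_of_monic _ _ fun i _ => hp i, ?_⟩
    ext i
    have h1 := Polynomial.aeval_algHom_apply (Pi.evalAlgHom R S i) x (∏ i, p i)
    change (Pi.evalAlgHom R S i) (Polynomial.aeval x (∏ i, p i)) = 0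
    rw [← h1, map_prod]
    exact Finset.prod_eq_zero (Finset.mem_univ i) (hpx i)

/-! ### The tuning module on a component, and its colength. -/

section Integers

variable {k : Type*} [Field k] {G : Type*} [Group G]
  {A : Type*} [CommRing A] [Algebra k⸨X⸩ A] [Algebra k⟦X⟧ A]
  [IsScalarTower k⟦X⟧ k⸨X⸩ A] [MulSemiringAction Gᵐᵒᵖ A] [SMulCommClass Gᵐᵒᵖ k⸨X⸩ A]
  {L : Type*} [Field L] [Algebra k⸨X⸩ L]

/-- Equivariance carries the values on all conjugates to values on the single component. -/
theorem tuningModule_ext [Finite G] (hA : IsGEtale k G A) (pr : A →ₐ[k⸨X⸩] L)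
    {n : ℕ} (ρ : G →* Matrix (Fin n) (Fin n) k⟦X⟧)
    {φ φ' : (Fin n → k⟦X⟧) →ₗ[k⟦X⟧] integralClosure k⟦X⟧ A}
    (hφ : φ ∈ tuningModule A ρ) (hφ' : φ' ∈ tuningModule A ρ)
    (h : ∀ m, pr (φ m : A) = pr (φ' m : A)) : φ = φ' := by
  refine LinearMap.ext fun m => Subtype.ext (sub_eq_zero.mp ?_)
  refine hA.eq_zero_of_forall pr fun g => ?_
  rw [smul_sub, map_sub, ← hφ g m, ← hφ' g m, h, sub_self]

variable [Algebra k⟦X⟧ L] [IsScalarTower k⟦X⟧ k⸨X⸩ L]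

theorem isIntegral_iff_forall_componentsHom [Finite G] (hA : IsGEtale k G A)
    (pr : A →ₐ[k⸨X⸩] L) (hpr : Function.Surjective pr) (a : A) :
    IsIntegral k⟦X⟧ a ↔ ∀ c, IsIntegral k⟦X⟧ (componentsHom (G := G) pr a c) := by
  rw [← isIntegral_pi_iff]
  exact (isIntegral_algHom_iff ((componentsHom (G := G) pr).restrictScalars k⟦X⟧)
    (componentsHom_injective hA pr hpr)).symm

/-- The integers of a `G`-étale algebra are a product of copies of the integers of a component. -/
theorem exists_integralClosure_equiv [Finite G] [FiniteDimensional k⸨X⸩ L] (hA : IsGEtale k G A)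
    (pr : A →ₐ[k⸨X⸩] L) (hpr : Function.Surjective pr)
    (hL : Module.finrank k⸨X⸩ L ≤ Nat.card (componentStabilizer (G := G) pr)) :
    Nonempty (integralClosure k⟦X⟧ A ≃ₗ[k⟦X⟧]
      (G ⧸ componentStabilizer (G := G) pr → integralClosure k⟦X⟧ L)) := by
  have hint := isIntegral_iff_forall_componentsHom hA pr hpr
  let f : integralClosure k⟦X⟧ A →ₗ[k⟦X⟧]
      (G ⧸ componentStabilizer (G := G) pr → integralClosure k⟦X⟧ L) :=
    { toFun := fun a c => ⟨componentsHom pr a.1 c, (hint a.1).mp a.2 c⟩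
      map_add' := fun a b => by ext c; simp
      map_smul' := fun r a => by
        ext c
        have := congrFun (map_smul ((componentsHom (G := G) pr).restrictScalars k⟦X⟧) r a.1) c
        exact this }
  refine ⟨LinearEquiv.ofBijective f ⟨?_, ?_⟩⟩
  · intro a b hab
    refine Subtype.ext (componentsHom_injective hA pr hpr (funext fun c => ?_))
    exact congrArg Subtype.val (congrFun hab c)
  · intro y
    obtain ⟨a, ha⟩ := (componentsHom_bijective hA pr hpr hL).2 fun c => (y c).1
    refine ⟨⟨a, (hint a).mpr fun c => ?_⟩, ?_⟩
    · rw [ha]; exact (y c).2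
    · ext c
      exact congrFun ha c

/-- An integral-valued map on the coordinates that is equivariant for the stabilizer of a
component lifts to the tuning module. -/
theorem exists_mem_tuningModule [Finite G] [FiniteDimensional k⸨X⸩ L] (hA : IsGEtale k G A)
    (pr : A →ₐ[k⸨X⸩] L) (hpr : Function.Surjective pr)
    (hL : Module.finrank k⸨X⸩ L ≤ Nat.card (componentStabilizer (G := G) pr))
    {n : ℕ} (ρ : G →* Matrix (Fin n) (Fin n) k⟦X⟧) (ψ : (Fin n → k⟦X⟧) →ₗ[k⟦X⟧] L)
    (hψ : ∀ (h : componentStabilizer (G := G) pr) (m : Fin n → k⟦X⟧),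
      ψ (m ᵥ* ρ h) = componentAct pr hpr h (ψ m))
    (hint : ∀ m, IsIntegral k⟦X⟧ (ψ m)) :
    ∃ φ ∈ tuningModule A ρ, ∀ m, pr (φ m : A) = ψ m := by
  let e := AlgEquiv.ofBijective _ (componentsHom_bijective hA pr hpr hL)
  let f : (Fin n → k⟦X⟧) →ₗ[k⟦X⟧] A :=
    (e.symm.toLinearMap.restrictScalars k⟦X⟧).comp
      (LinearMap.pi fun c : G ⧸ componentStabilizer (G := G) pr => ψ.comp (ρ c.out).vecMulLinear)
  have hf : ∀ m c, componentsHom pr (f m) c = ψ (m ᵥ* ρ c.out) := by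
    intro m c
    have : e (f m) = fun c => ψ (m ᵥ* ρ c.out) := e.apply_symm_apply _
    exact congrFun this c
  -- `f` is defined through coset representatives; the stabilizer element relating `g` to its
  -- representative acts on both sides and cancels, since `ψ` is equivariant for it.
  have key : ∀ m g, pr (f m <• g) = ψ (m ᵥ* ρ g) := by
    intro m g
    obtain ⟨h, hg, hh⟩ := exists_smul_out (G := G) pr hpr g
    have h1 := hh (f m)
    rw [hf, hg, map_mul, ← Matrix.vecMul_vecMul, hψ] at h1
    exact ((componentAct pr hpr h).injective h1).symm
  have hfint : ∀ m, IsIntegral k⟦X⟧ (f m) := fun m =>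
    (isIntegral_iff_forall_componentsHom hA pr hpr _).mpr fun c => by
      rw [hf]; exact hint _
  refine ⟨f.codRestrict (Subalgebra.toSubmodule (integralClosure k⟦X⟧ A)) hfint, ?_, ?_⟩
  · intro g m
    change f _ = f m <• g
    rw [← sub_eq_zero]
    refine hA.eq_zero_of_forall pr fun g' => ?_
    rw [smul_sub, map_sub, key, smul_smul, ← MulOpposite.op_mul, key, map_mul,
      Matrix.vecMul_vecMul, sub_self]
  · intro m
    have := key m 1
    rw [MulOpposite.op_one, one_smul, map_one, Matrix.vecMul_one] at this
    exact this

/-- The determinant of `n` elements of the tuning module of a representation with trivial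
determinant lies in the base field. -/
theorem det_mem_range {n : ℕ} (hA : IsGEtale k G A)
    (ρ : G →* Matrix (Fin n) (Fin n) k⟦X⟧) (hρ : ∀ g, (ρ g).det = 1)
    (φ : Fin n → (Fin n → k⟦X⟧) →ₗ[k⟦X⟧] integralClosure k⟦X⟧ A)
    (hφ : ∀ i, φ i ∈ tuningModule A ρ) :
    (Matrix.of fun i j => (φ i (Pi.single j 1) : A)).det ∈ (algebraMap k⸨X⸩ A).range := by
  refine hA.fixed _ fun g => ?_
  set D : Matrix (Fin n) (Fin n) A := Matrix.of fun i j => (φ i (Pi.single j 1) : A) with hD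
  have h1 : MulOpposite.op g • D.det = (D.map (MulOpposite.op g • ·)).det := by
    exact RingHom.map_det (MulSemiringAction.toRingHom Gᵐᵒᵖ A (MulOpposite.op g)) D
  -- Acting by `g` amounts to multiplying `D` by the transpose of `ρ g`, whose determinant is `1`.
  have h2 : D.map (MulOpposite.op g • ·) = D * ((ρ g).map (algebraMap k⟦X⟧ A))ᵀ := by
    ext i j
    simp only [Matrix.map_apply, Matrix.mul_apply, Matrix.transpose_apply, hD, Matrix.of_apply]
    rw [← hφ i g, Matrix.single_one_vecMul, pi_eq_sum_univ' (R := k⟦X⟧) (Matrix.row (ρ g) j), map_sum]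
    simp only [map_smul, AddSubmonoidClass.coe_finsetSum, Subalgebra.coe_smul]
    exact Finset.sum_congr rfl fun l _ => (Algebra.smul_def _ _).trans (mul_comm _ _)
  have h3 : ((ρ g).map (algebraMap k⟦X⟧ A)).det = 1 := by
    have := RingHom.map_det (algebraMap k⟦X⟧ A) (ρ g)
    rw [hρ, map_one] at this
    exact this.symm
  rw [h1, h2, Matrix.det_mul, Matrix.det_transpose, h3, mul_one]

/-- If the tuning module of a representation with trivial determinant is spanned by `n` elements
whose determinant on one component is `r ∈ k⟦X⟧`, then the colength is `#G * ord r`. -/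
theorem tuningColength_eq [Finite G] [FiniteDimensional k⸨X⸩ L] [Algebra.IsSeparable k⸨X⸩ L]
    (hA : IsGEtale k G A)
    (pr : A →ₐ[k⸨X⸩] L) (hpr : Function.Surjective pr)
    (hL : Module.finrank k⸨X⸩ L ≤ Nat.card (componentStabilizer (G := G) pr))
    {n : ℕ} (ρ : G →* Matrix (Fin n) (Fin n) k⟦X⟧) (hρ : ∀ g, (ρ g).det = 1)
    (φ : Fin n → (Fin n → k⟦X⟧) →ₗ[k⟦X⟧] integralClosure k⟦X⟧ A)
    (hφ : tuningModule A ρ = Submodule.span k⟦X⟧ (Set.range φ))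
    {r : k⟦X⟧} (hr : r ≠ 0)
    (hdet : (Matrix.of fun i j => pr (φ i (Pi.single j 1) : A)).det =
      algebraMap k⸨X⸩ L (algebraMap k⟦X⟧ k⸨X⸩ r)) :
    tuningColength A ρ = Nat.card G * Ring.ord k⟦X⟧ r := by
  classical
  have hφm : ∀ i, φ i ∈ tuningModule A ρ := fun i => by
    rw [hφ]; exact Submodule.subset_span ⟨i, rfl⟩
  have : Module.IsTorsionFree k⟦X⟧ L := .trans_faithfulSMul k⟦X⟧ k⸨X⸩ L
  have : Module.Free k⟦X⟧ (integralClosure k⟦X⟧ L) := IsIntegralClosure.module_free k⟦X⟧ k⸨X⸩ L _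
  have : Module.Finite k⟦X⟧ (integralClosure k⟦X⟧ L) := IsIntegralClosure.finite k⟦X⟧ k⸨X⸩ L _
  obtain ⟨e⟩ := exists_integralClosure_equiv hA pr hpr hL
  have : Module.Free k⟦X⟧ (integralClosure k⟦X⟧ A) := Module.Free.of_equiv e.symm
  have : Module.Finite k⟦X⟧ (integralClosure k⟦X⟧ A) := Module.Finite.equiv e.symm
  have : Fintype (G ⧸ componentStabilizer (G := G) pr) := Fintype.ofFinite _
  have hrank : Module.finrank k⟦X⟧ (integralClosure k⟦X⟧ A) = Nat.card G := by
    rw [e.finrank_eq, Module.finrank_pi_fintype, Finset.sum_const, Finset.card_univ, smul_eq_mul,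
      ← Nat.card_eq_fintype_card, IsIntegralClosure.rank k⟦X⟧ k⸨X⸩ L,
      card_quotient_mul_finrank hA pr hpr hL]
  let B := integralClosure k⟦X⟧ A
  let D : Matrix (Fin n) (Fin n) B := Matrix.of fun i j => φ i (Pi.single j 1)
  have hDdet : D.det = algebraMap k⟦X⟧ B r := by
    apply Subtype.ext
    have h1 : ((D.det : B) : A) = (Matrix.of fun i j => (φ i (Pi.single j 1) : A)).det :=
      RingHom.map_det (B.val : B →+* A) D
    -- An element of `K` is determined by its value on one component.
    obtain ⟨z, hz⟩ := det_mem_range hA ρ hρ φ hφm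
    have h2 : pr (Matrix.of fun i j => (φ i (Pi.single j 1) : A)).det =
        (Matrix.of fun i j => pr (φ i (Pi.single j 1) : A)).det :=
      RingHom.map_det (pr : A →+* L) _
    rw [hdet, ← hz, AlgHom.commutes] at h2
    rw [h1, ← hz, (algebraMap k⸨X⸩ L).injective h2]
    exact (IsScalarTower.algebraMap_apply k⟦X⟧ k⸨X⸩ A r).symm
  let E : ((Fin n → k⟦X⟧) →ₗ[k⟦X⟧] B) ≃ₗ[B] (Fin n → B) :=
    ((Pi.basisFun k⟦X⟧ (Fin n)).constr B).symm
  have hE : ∀ ψ j, E ψ j = ψ (Pi.single j 1) := by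
    intro ψ j
    simp [E, Module.Basis.constr]
  have hmap : (Submodule.span B (tuningModule A ρ : Set ((Fin n → k⟦X⟧) →ₗ[k⟦X⟧] B))).map
      (E : ((Fin n → k⟦X⟧) →ₗ[k⟦X⟧] B) →ₗ[B] (Fin n → B)) =
      Submodule.span B (Set.range D.row) := by
    rw [hφ, Submodule.span_span_of_tower, Submodule.map_span, ← Set.range_comp]
    congr 2
    ext i j
    exact congrArg Subtype.val (hE (φ i) j)
  have key := length_quotient_span_rows D hr hDdet
  rw [hrank] at key
  rw [← key]
  exact ((Submodule.Quotient.equiv _ _ E hmap).restrictScalars k⟦X⟧).length_eq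

end Integers

/-! ### Calculus of the additive valuation at a prime. -/

section Ord

open IsDedekindDomain

variable {R : Type*} [CommRing R] [IsDedekindDomain R] {F : Type*} [Field F] [Algebra R F]
  [IsFractionRing R F] (P : HeightOneSpectrum R)

/-- Zero has order `0` by convention rather than infinity: nonnegativity statements then need no
nonvanishing hypothesis, while multiplicativity and strict comparisons do. -/
theorem ord_zero : ord P (0 : F) = 0 := by simp [ord]

theorem ord_mul {x y : F} (hx : x ≠ 0) (hy : y ≠ 0) : ord P (x * y) = ord P x + ord P y := by
  rw [ord, map_mul, WithZero.log_mul (by simpa using hx) (by simpa using hy), ord, ord]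
  ring

theorem ord_inv (x : F) : ord P x⁻¹ = -ord P x := by
  simp [ord, WithZero.log_inv]

theorem ord_pow (x : F) (n : ℕ) : ord P (x ^ n) = n * ord P x := by
  simp [ord, WithZero.log_pow]

theorem ord_zpow (x : F) (n : ℤ) : ord P (x ^ n) = n * ord P x := by
  simp [ord, WithZero.log_zpow]

theorem ord_neg (x : F) : ord P (-x) = ord P x := by
  rw [ord, ord, Valuation.map_neg]

theorem ord_lt_ord_iff {x y : F} (hx : x ≠ 0) (hy : y ≠ 0) :
    ord P x < ord P y ↔ P.valuation F y < P.valuation F x := by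
  rw [ord, ord, neg_lt_neg_iff, WithZero.log_lt_log (by simpa using hy) (by simpa using hx)]

theorem ord_nonneg_iff (x : F) : 0 ≤ ord P x ↔ P.valuation F x ≤ 1 := by
  rcases eq_or_ne x 0 with rfl | hx
  · simp [ord]
  · rw [ord, le_neg, neg_zero, ← WithZero.log_one, WithZero.log_le_log (by simpa using hx) one_ne_zero]

theorem ord_add_of_lt {x y : F} (hx : x ≠ 0) (hy : y ≠ 0) (h : ord P x < ord P y) :
    x + y ≠ 0 ∧ ord P (x + y) = ord P x := by
  have h1 := Valuation.map_add_eq_of_lt_right _ ((ord_lt_ord_iff P hx hy).mp h)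
  rw [add_comm] at h1
  refine ⟨fun h0 => ?_, by rw [ord, h1, ord]⟩
  rw [h0, map_zero] at h1
  exact hx ((map_eq_zero _).mp h1.symm)

theorem ord_add_of_ne {x y : F} (hx : x ≠ 0) (hy : y ≠ 0) (h : ord P x ≠ ord P y) :
    x + y ≠ 0 ∧ ord P (x + y) = min (ord P x) (ord P y) := by
  rcases lt_or_gt_of_ne h with h | h
  · rw [min_eq_left h.le]; exact ord_add_of_lt P hx hy h
  · rw [min_eq_right h.le, add_comm]; exact ord_add_of_lt P hy hx h

theorem ord_add_nonneg {x y : F} (hx : 0 ≤ ord P x) (hy : 0 ≤ ord P y) : 0 ≤ ord P (x + y) := by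
  rw [ord_nonneg_iff] at *
  exact Valuation.map_add_le _ hx hy

theorem ord_nonneg_of_add {x y : F} (h : x ≠ 0 → y ≠ 0 → ord P x ≠ ord P y)
    (hxy : 0 ≤ ord P (x + y)) : 0 ≤ ord P x ∧ 0 ≤ ord P y := by
  rcases eq_or_ne x 0 with rfl | hx
  · simpa [ord_zero] using hxy
  rcases eq_or_ne y 0 with rfl | hy
  · simpa [ord_zero] using hxy
  rw [(ord_add_of_ne P hx hy (h hx hy)).2] at hxy
  exact le_min_iff.mp hxy

/-- Summands of pairwise distinct orders cannot cancel, so the sum has the least of their orders.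
Distinctness is asked only of nonzero summands, because of the value at zero. -/
theorem ord_nonneg_of_add_add {x y z : F} (hxy : x ≠ 0 → y ≠ 0 → ord P x ≠ ord P y)
    (hyz : y ≠ 0 → z ≠ 0 → ord P y ≠ ord P z) (hxz : x ≠ 0 → z ≠ 0 → ord P x ≠ ord P z)
    (h : 0 ≤ ord P (x + y + z)) : 0 ≤ ord P x ∧ 0 ≤ ord P y ∧ 0 ≤ ord P z := by
  have h1 : 0 ≤ ord P (x + y) ∧ 0 ≤ ord P z := by
    refine ord_nonneg_of_add P (fun h0 hz => ?_) h
    rcases eq_or_ne x 0 with rfl | hx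
    · rw [zero_add] at h0 ⊢; exact hyz h0 hz
    rcases eq_or_ne y 0 with rfl | hy
    · rw [add_zero] at h0 ⊢; exact hxz h0 hz
    rw [(ord_add_of_ne P hx hy (hxy hx hy)).2]
    rcases min_choice (ord P x) (ord P y) with h' | h' <;> rw [h']
    exacts [hxz hx hz, hyz hy hz]
  obtain ⟨h2, h3⟩ := ord_nonneg_of_add P hxy h1.1
  exact ⟨h2, h3, h1.2⟩

theorem ord_algebraMap_nonneg (r : R) : 0 ≤ ord P (algebraMap R F r) :=
  (ord_nonneg_iff P _).mpr (P.valuation_le_one r)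

theorem ord_algebraMap_eq_zero {r : R} (hr : IsUnit r) : ord P (algebraMap R F r) = 0 := by
  obtain ⟨u, rfl⟩ := hr
  have h1 := ord_algebraMap_nonneg (F := F) P (u : R)
  have h2 := ord_algebraMap_nonneg (F := F) P ((u⁻¹ : Rˣ) : R)
  have h3 : (algebraMap R F ((u⁻¹ : Rˣ) : R)) = (algebraMap R F (u : R))⁻¹ := by
    refine eq_inv_of_mul_eq_one_left ?_
    rw [← map_mul]; simp
  rw [h3, ord_inv] at h2
  omega

end Ord

/-! ### Integrality, ramification and residue degree in `L`. -/

section OrdIntegers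

open IsDedekindDomain

variable {k : Type*} [Field k] {L : Type*} [Field L] [Algebra k⸨X⸩ L]
    [Algebra k⟦X⟧ L] [IsScalarTower k⟦X⟧ k⸨X⸩ L] [FiniteDimensional k⸨X⸩ L]
    [Algebra.IsSeparable k⸨X⸩ L]

theorem isIntegral_iff_forall_ord (x : L) : IsIntegral k⟦X⟧ x ↔
    ∀ P : HeightOneSpectrum (integralClosure k⟦X⟧ L), 0 ≤ ord P x := by
  constructor
  · exact fun h P => ord_algebraMap_nonneg P (⟨x, h⟩ : integralClosure k⟦X⟧ L)
  · intro h
    obtain ⟨y, rfl⟩ := HeightOneSpectrum.mem_integers_of_valuation_le_one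
      (R := integralClosure k⟦X⟧ L) L x fun P => (ord_nonneg_iff P x).mp (h P)
    exact y.2

theorem ord_eq_zero_of_isIntegral_inv (P : HeightOneSpectrum (integralClosure k⟦X⟧ L)) {x : L}
    (h : IsIntegral k⟦X⟧ x) (h' : IsIntegral k⟦X⟧ x⁻¹) : ord P x = 0 := by
  have h1 := (isIntegral_iff_forall_ord x).mp h P
  have h2 := (isIntegral_iff_forall_ord x⁻¹).mp h' P
  rw [ord_inv] at h2
  omega

theorem liesOver_idealX (P : HeightOneSpectrum (integralClosure k⟦X⟧ L)) :
    P.asIdeal.LiesOver (PowerSeries.idealX k).asIdeal := by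
  refine ⟨?_⟩
  have h1 : (PowerSeries.idealX k).asIdeal.IsMaximal := (PowerSeries.idealX k).isMaximal
  have h2 : (P.asIdeal.under k⟦X⟧).IsMaximal := by
    have := P.isMaximal
    exact Ideal.isMaximal_comap_of_isIntegral_of_isMaximal (R := k⟦X⟧) P.asIdeal
  rw [IsLocalRing.eq_maximalIdeal h1, IsLocalRing.eq_maximalIdeal h2]

theorem ord_algebraMap (P : HeightOneSpectrum (integralClosure k⟦X⟧ L)) (c : k⸨X⸩) :
    ord P (algebraMap k⸨X⸩ L c) =
      P.asIdeal.ramificationIdx k⟦X⟧ * ord (PowerSeries.idealX k) c := by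
  have : Module.IsTorsionFree k⟦X⟧ L := .trans_faithfulSMul k⟦X⟧ k⸨X⸩ L
  have := liesOver_idealX P
  have h := HeightOneSpectrum.valuation_liesOver L (PowerSeries.idealX k) P c
  rw [Ideal.ramificationIdx'_eq_ramificationIdx _ _ (PowerSeries.idealX k).ne_bot] at h
  rw [ord, ord, ← h, WithZero.log_pow, nsmul_eq_mul]
  ring

theorem ramificationIdx_pos (P : HeightOneSpectrum (integralClosure k⟦X⟧ L)) :
    0 < P.asIdeal.ramificationIdx k⟦X⟧ := by
  have : Module.Finite k⟦X⟧ (integralClosure k⟦X⟧ L) := IsIntegralClosure.finite k⟦X⟧ k⸨X⸩ L _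
  have := P.isPrime
  exact Ideal.ramificationIdx_pos _ _

/-- This is a single term of the identity `∑ e f = [L : K]`; uniqueness of the prime above `X` is
not needed. -/
theorem ramificationIdx_mul_inertiaDeg_le (P : HeightOneSpectrum (integralClosure k⟦X⟧ L)) :
    P.asIdeal.ramificationIdx k⟦X⟧ * P.asIdeal.inertiaDeg k⟦X⟧ ≤ Module.finrank k⸨X⸩ L := by
  have : Module.IsTorsionFree k⟦X⟧ L := .trans_faithfulSMul k⟦X⟧ k⸨X⸩ L
  have : Module.Free k⟦X⟧ (integralClosure k⟦X⟧ L) := IsIntegralClosure.module_free k⟦X⟧ k⸨X⸩ L _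
  have : Module.Finite k⟦X⟧ (integralClosure k⟦X⟧ L) := IsIntegralClosure.finite k⟦X⟧ k⸨X⸩ L _
  have := liesOver_idealX P
  have := P.isPrime
  let p := (PowerSeries.idealX k).asIdeal
  have : p.IsPrime := (PowerSeries.idealX k).isPrime
  have : Fintype (p.primesOver (integralClosure k⟦X⟧ L)) :=
    @Fintype.ofFinite _ (IsDedekindDomain.primesOver_finite _ _)
  rw [← IsIntegralClosure.rank k⟦X⟧ k⸨X⸩ L (integralClosure k⟦X⟧ L),
    ← Ideal.sum_ramification_inertia_eq_finrank p]
  exact Finset.single_le_sum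
    (f := fun q : p.primesOver (integralClosure k⟦X⟧ L) =>
      q.1.ramificationIdx k⟦X⟧ * q.1.inertiaDeg k⟦X⟧)
    (fun _ _ => Nat.zero_le _) (Finset.mem_univ (Ideal.primesOver.mk p P.asIdeal))

theorem inertiaDeg_pos (P : HeightOneSpectrum (integralClosure k⟦X⟧ L)) :
    0 < P.asIdeal.inertiaDeg k⟦X⟧ := by
  have : Module.Finite k⟦X⟧ (integralClosure k⟦X⟧ L) := IsIntegralClosure.finite k⟦X⟧ k⸨X⸩ L _
  have := P.isPrime
  exact Ideal.inertiaDeg_pos _ _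

/-- If `μ ∈ k` is not a square but has a square root in `L`, then residue degrees are nontrivial. -/
theorem inertiaDeg_ne_one_of_sq (P : HeightOneSpectrum (integralClosure k⟦X⟧ L)) {μ : k}
    (hμ : ¬ IsSquare μ) {α : L} (hα : α ^ 2 = algebraMap k⸨X⸩ L (HahnSeries.C μ)) :
    P.asIdeal.inertiaDeg k⟦X⟧ ≠ 1 := by
  intro h1
  have hC : algebraMap k⸨X⸩ L (HahnSeries.C μ) = algebraMap k⟦X⟧ L (PowerSeries.C μ) := by
    rw [IsScalarTower.algebraMap_apply k⟦X⟧ k⸨X⸩ L]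
    simp
  rw [hC] at hα
  let p := (PowerSeries.idealX k).asIdeal
  have := liesOver_idealX P
  have hp : p.IsMaximal := (PowerSeries.idealX k).isMaximal
  have := P.isMaximal
  rw [Ideal.inertiaDeg_eq_of_isMaximal p] at h1
  have hint : IsIntegral k⟦X⟧ α := by
    refine IsIntegral.of_pow (n := 2) (by norm_num) ?_
    rw [hα]
    exact isIntegral_algebraMap
  let α' : integralClosure k⟦X⟧ L := ⟨α, hint⟩
  let : Field (k⟦X⟧ ⧸ p) := Ideal.Quotient.field p
  -- With residue degree one, `α` is congruent to some `r ∈ k⟦X⟧`, so `r² ≡ μ` modulo `X` and `μ` is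
  -- the square of the constant coefficient of `r`.
  obtain ⟨c, hc⟩ := (Module.Free.bijective_algebraMap_of_finrank_eq_one h1).2 (Ideal.Quotient.mk P.asIdeal α')
  obtain ⟨r, rfl⟩ := Ideal.Quotient.mk_surjective c
  have h2 : algebraMap k⟦X⟧ (integralClosure k⟦X⟧ L) r - α' ∈ P.asIdeal := by
    rw [← Ideal.Quotient.eq]; exact hc
  have h3 : α' ^ 2 = algebraMap k⟦X⟧ (integralClosure k⟦X⟧ L) (PowerSeries.C μ) :=
    Subtype.ext hα
  have h4 : algebraMap k⟦X⟧ (integralClosure k⟦X⟧ L) (r ^ 2 - PowerSeries.C μ) ∈ P.asIdeal := by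
    rw [map_sub, ← h3, map_pow, sq_sub_sq]
    exact Ideal.mul_mem_left _ _ h2
  have h5 : r ^ 2 - PowerSeries.C μ ∈ p := by
    rw [P.asIdeal.over_def p]; exact h4
  rw [show p = Ideal.span {PowerSeries.X} from rfl, Ideal.mem_span_singleton,
    PowerSeries.X_dvd_iff] at h5
  simp only [map_sub, map_pow, PowerSeries.constantCoeff_C] at h5
  exact hμ ⟨PowerSeries.constantCoeff r, by rw [← sq]; exact (sub_eq_zero.mp h5).symm⟩

end OrdIntegers

/-! ### Orders in the base field `k⸨X⸩`. -/

section OrdLaurent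

variable {k : Type*} [Field k]

theorem ord_idealX_X :
    ord (PowerSeries.idealX k) (algebraMap k⟦X⟧ k⸨X⸩ PowerSeries.X) = 1 := by
  rw [ord, IsDedekindDomain.HeightOneSpectrum.valuation_of_algebraMap, PowerSeries.intValuation_X,
    WithZero.log_exp, neg_neg]

theorem ord_idealX_C {d : k} : ord (PowerSeries.idealX k) (HahnSeries.C d : k⸨X⸩) = 0 := by
  rcases eq_or_ne d 0 with rfl | hd
  · rw [map_zero, ord_zero]
  have h : (HahnSeries.C d : k⸨X⸩) = algebraMap k⟦X⟧ k⸨X⸩ (PowerSeries.C d) := by simp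
  rw [h]
  exact ord_algebraMap_eq_zero _ (hd.isUnit.map PowerSeries.C)

theorem exists_algebraMap_of_ord_nonneg {c : k⸨X⸩} (hc : 0 ≤ ord (PowerSeries.idealX k) c) :
    ∃ r : k⟦X⟧, algebraMap k⟦X⟧ k⸨X⸩ r = c :=
  (LaurentSeries.val_le_one_iff_eq_coe k c).mp ((ord_nonneg_iff _ c).mp hc)

theorem ringOrd_eq_ord {r : k⟦X⟧} (hr : r ≠ 0) :
    ((Ring.ord k⟦X⟧ r).toNat : ℤ) = ord (PowerSeries.idealX k) (algebraMap k⟦X⟧ k⸨X⸩ r) ∧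
      Ring.ord k⟦X⟧ r ≠ ⊤ := by
  obtain ⟨n, u, rfl⟩ := IsDiscreteValuationRing.eq_unit_mul_pow_irreducible hr
    (PowerSeries.X_irreducible (R := k))
  have hX : (PowerSeries.X : k⟦X⟧) ∈ nonZeroDivisors k⟦X⟧ :=
    mem_nonZeroDivisors_of_ne_zero PowerSeries.X_ne_zero
  have h1 : Ring.ord k⟦X⟧ ((u : k⟦X⟧) * PowerSeries.X ^ n) = n := by
    rw [Ring.ord_mul_of_isUnit_left u.isUnit, Ring.ord_pow hX,
      Ring.ord_of_irreducible PowerSeries.X_irreducible]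
    simp
  rw [h1, map_mul, map_pow, ord_mul _ (u.isUnit.map (algebraMap k⟦X⟧ k⸨X⸩)).ne_zero (by simp), ord_algebraMap_eq_zero _ u.isUnit,
    ord_pow, ord_idealX_X]
  simp

end OrdLaurent

/-! ### Generators of `L` over `K` and the anti-invariant eigenspace. -/

section Generators

theorem exists_add_mul_of_mem_adjoin {K L : Type*} [Field K] [Field L] [Algebra K L] {α : L} {a : K}
    (hα : α ^ 2 = algebraMap K L a) {x : L} (hx : x ∈ K⟮α⟯) :
    ∃ c d : K, x = algebraMap K L c + algebraMap K L d * α := by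
  have hint : IsIntegral K α := .of_pow (n := 2) (by norm_num) (by rw [hα]; exact isIntegral_algebraMap)
  rw [← IntermediateField.mem_toSubalgebra,
    IntermediateField.adjoin_simple_toSubalgebra_of_isAlgebraic hint.isAlgebraic] at hx
  induction hx using Algebra.adjoin_induction with
  | mem x hx => exact ⟨0, 1, by simp [Set.mem_singleton_iff.mp hx]⟩
  | algebraMap r => exact ⟨r, 0, by simp⟩
  | add x y _ _ h1 h2 =>
    obtain ⟨c, d, rfl⟩ := h1
    obtain ⟨c', d', rfl⟩ := h2
    exact ⟨c + c', d + d', by simp only [map_add]; ring⟩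
  | mul x y _ _ h1 h2 =>
    obtain ⟨c, d, rfl⟩ := h1
    obtain ⟨c', d', rfl⟩ := h2
    refine ⟨c * c' + d * d' * a, c * d' + d * c', ?_⟩
    simp only [map_add, map_mul, ← hα]
    ring

theorem exists_quadratic_of_adjoin_eq_top {F L : Type*} [Field F] [Field L] [Algebra F L] {β : L}
    {c : F} (hβ : β ^ 3 = β + algebraMap F L c) (htop : F⟮β⟯ = ⊤) (x : L) :
    ∃ q₀ q₁ q₂ : F,
      x = algebraMap F L q₀ + algebraMap F L q₁ * β + algebraMap F L q₂ * β ^ 2 := by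
  have hint : IsIntegral F β := by
    refine ⟨Polynomial.X ^ 3 - (Polynomial.X + Polynomial.C c), ?_, ?_⟩
    · apply Polynomial.monic_X_pow_sub
      compute_degree!
    · simp [hβ]
  have hx : x ∈ F⟮β⟯ := by rw [htop]; trivial
  rw [← IntermediateField.mem_toSubalgebra,
    IntermediateField.adjoin_simple_toSubalgebra_of_isAlgebraic hint.isAlgebraic] at hx
  induction hx using Algebra.adjoin_induction with
  | mem x hx => exact ⟨0, 1, 0, by simp [Set.mem_singleton_iff.mp hx]⟩
  | algebraMap r => exact ⟨r, 0, 0, by simp⟩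
  | add x y _ _ h1 h2 =>
    obtain ⟨c, d, e, rfl⟩ := h1
    obtain ⟨c', d', e', rfl⟩ := h2
    exact ⟨c + c', d + d', e + e', by simp only [map_add]; ring⟩
  | mul x y _ _ h1 h2 =>
    obtain ⟨p, q, r, rfl⟩ := h1
    obtain ⟨p', q', r', rfl⟩ := h2
    refine ⟨p * p' + (q * r' + r * q') * c, p * q' + q * p' + (q * r' + r * q') + r * r' * c,
      p * r' + q * q' + r * p' + r * r', ?_⟩
    simp only [map_add, map_mul]
    linear_combination (algebraMap F L q * algebraMap F L r' + algebraMap F L r * algebraMap F L q'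
      + algebraMap F L r * algebraMap F L r' * β) * hβ

theorem finrank_le_of_generators {K L : Type*} [Field K] [Field L] [Algebra K L]
    [FiniteDimensional K L] (Q : IntermediateField K L) {α β : L} {a : K} {c : Q}
    (hα : α ^ 2 = algebraMap K L a) (hαQ : K⟮α⟯ = Q)
    (hβ : β ^ 3 = β + algebraMap Q L c) (hβQ : Q⟮β⟯ = ⊤) : Module.finrank K L ≤ 6 := by
  let v : Fin 6 → L := ![1, α, β, α * β, β ^ 2, α * β ^ 2]
  have hspan : Submodule.span K (Set.range v) = ⊤ := by
    refine eq_top_iff.mpr fun x _ => ?_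
    obtain ⟨q₀, q₁, q₂, rfl⟩ := exists_quadratic_of_adjoin_eq_top hβ hβQ x
    obtain ⟨c₀, d₀, h₀⟩ := exists_add_mul_of_mem_adjoin hα (x := (q₀ : L)) (by rw [hαQ]; exact q₀.2)
    obtain ⟨c₁, d₁, h₁⟩ := exists_add_mul_of_mem_adjoin hα (x := (q₁ : L)) (by rw [hαQ]; exact q₁.2)
    obtain ⟨c₂, d₂, h₂⟩ := exists_add_mul_of_mem_adjoin hα (x := (q₂ : L)) (by rw [hαQ]; exact q₂.2)
    rw [Submodule.mem_span_range_iff_exists_fun]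
    refine ⟨![c₀, d₀, c₁, d₁, c₂, d₂], ?_⟩
    change _ = (q₀ : L) + (q₁ : L) * β + (q₂ : L) * β ^ 2
    rw [h₀, h₁, h₂]
    simp [Fin.sum_univ_succ, v, Algebra.smul_def]
    ring
  calc Module.finrank K L = Module.finrank K (⊤ : Submodule K L) := (finrank_top K L).symm
    _ = (Set.range v).finrank K := by rw [Set.finrank, hspan]
    _ ≤ Fintype.card (Fin 6) := finrank_range_le_card v
    _ = 6 := by simp

/-- The eigenspace `y ∘ τ = -y` of the transposition. -/
theorem exists_of_anti_invariant {K L : Type*} [Field K] [CharP K 3] [Field L] [Algebra K L]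
    (Q : IntermediateField K L) {α β : L} {a : K} {c : Q}
    (hα : α ^ 2 = algebraMap K L a) (hαQ : K⟮α⟯ = Q)
    (hβ : β ^ 3 = β + algebraMap Q L c) (hβQ : Q⟮β⟯ = ⊤) (τ : L →ₐ[K] L) (hτα : τ α = -α)
    (hτβ : τ β = -β) {y : L} (hy : τ y = -y) :
    ∃ c₀ c₁ c₂ : K, y = algebraMap K L c₀ * α + algebraMap K L c₁ * β +
      algebraMap K L c₂ * (α * β ^ 2) := by
  obtain ⟨q₀, q₁, q₂, h⟩ := exists_quadratic_of_adjoin_eq_top hβ hβQ y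
  obtain ⟨c₀, d₀, h₀⟩ := exists_add_mul_of_mem_adjoin hα (x := (q₀ : L)) (by rw [hαQ]; exact q₀.2)
  obtain ⟨c₁, d₁, h₁⟩ := exists_add_mul_of_mem_adjoin hα (x := (q₁ : L)) (by rw [hαQ]; exact q₁.2)
  obtain ⟨c₂, d₂, h₂⟩ := exists_add_mul_of_mem_adjoin hα (x := (q₂ : L)) (by rw [hαQ]; exact q₂.2)
  change y = (q₀ : L) + (q₁ : L) * β + (q₂ : L) * β ^ 2 at h
  rw [h₀, h₁, h₂] at h
  refine ⟨d₀, c₁, d₂, ?_⟩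
  have h3 : (3 : L) = 0 := by
    have : CharP L 3 := charP_of_injective_algebraMap (algebraMap K L).injective 3
    exact_mod_cast CharP.cast_eq_zero L 3
  -- In characteristic `3`, `-2 = 1`, so `τ - 1` is the projection onto the `-1`-eigenspace. It
  -- kills `1`, `αβ`, `β²` and fixes `α`, `β`, `αβ²`.
  have h4 : y = τ y - y := by linear_combination (y) * h3 - hy
  rw [h4]
  conv_lhs => rw [h]
  simp only [map_add, map_mul, map_pow, AlgHom.commutes, hτα, hτβ]
  linear_combination (-(algebraMap K L d₀ * α + algebraMap K L c₁ * β +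
      algebraMap K L d₂ * (α * β ^ 2))) * h3

end Generators

/-! ### Constants of `Q` and poles of Artin–Schreier representatives. -/

section Constants

variable {k : Type*} [Field k] {L : Type*} [Field L] [Algebra k⸨X⸩ L]

theorem isIntegralElem_C_inv {x : L}
    (hx : ((algebraMap k⸨X⸩ L).comp HahnSeries.C).IsIntegralElem x) :
    ((algebraMap k⸨X⸩ L).comp HahnSeries.C).IsIntegralElem x⁻¹ := by
  let := ((algebraMap k⸨X⸩ L).comp (HahnSeries.C (Γ := ℤ) (R := k))).toAlgebra
  exact (IsIntegral.inv (R := k) (x := x) hx)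

/-- Viewing the polar part as a polynomial in `π⁻¹` with constant coefficients lets its degree
measure the pole, and the degree is prime to `3` because the coefficients at multiples of `3`
vanish. -/
theorem exists_polynomial_of_mem_artinSchreierReps (Q : IntermediateField k⸨X⸩ L) {lam π c : L}
    (hc : c ∈ artinSchreierReps Q lam π) :
    ∃ (n : ℤ) (p : Polynomial L), (∀ j, p.coeff j ∈ residueConstants Q) ∧
      (∀ j, 3 ∣ j → p.coeff j = 0) ∧ c = n • lam + p.eval π⁻¹ := by
  obtain ⟨x, hx, y, hy, rfl⟩ := AddSubgroup.mem_sup.mp hc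
  obtain ⟨n, rfl⟩ := AddSubgroup.mem_zmultiples_iff.mp hx
  suffices ∃ p : Polynomial L, (∀ j, p.coeff j ∈ residueConstants Q) ∧
      (∀ j, 3 ∣ j → p.coeff j = 0) ∧ y = p.eval π⁻¹ by
    obtain ⟨p, h1, h2, rfl⟩ := this
    exact ⟨n, p, h1, h2, rfl⟩
  have hzero : (0 : L) ∈ residueConstants Q := ⟨zero_mem _, RingHom.isIntegralElem_zero _⟩
  clear hc
  induction hy using AddSubgroup.closure_induction with
  | mem y hy =>
    obtain ⟨j, hj, hj3, κ, hκ, rfl⟩ := hy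
    refine ⟨Polynomial.monomial j κ, fun i => ?_, fun i hi => ?_, by simp⟩
    · rw [Polynomial.coeff_monomial]
      split_ifs
      exacts [hκ, hzero]
    · rw [Polynomial.coeff_monomial, if_neg]
      rintro rfl
      exact hj3 hi
  | zero => exact ⟨0, fun _ => by simpa using hzero, by simp, by simp⟩
  | add x y _ _ h1 h2 =>
    obtain ⟨p, h1, h1', rfl⟩ := h1
    obtain ⟨q, h2, h2', rfl⟩ := h2
    refine ⟨p + q, fun j => ?_, fun j hj => ?_, by simp⟩
    · rw [Polynomial.coeff_add]
      exact ⟨add_mem (h1 j).1 (h2 j).1, RingHom.IsIntegralElem.add _ (h1 j).2 (h2 j).2⟩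
    · simp [h1' j hj, h2' j hj]
  | neg x _ h1 =>
    obtain ⟨p, h1, h1', rfl⟩ := h1
    refine ⟨-p, fun j => ?_, fun j hj => ?_, by simp⟩
    · rw [Polynomial.coeff_neg]
      exact ⟨neg_mem (h1 j).1, RingHom.IsIntegralElem.neg _ (h1 j).2⟩
    · simp [h1' j hj]

variable [Algebra k⟦X⟧ L] [IsScalarTower k⟦X⟧ k⸨X⸩ L]

theorem isIntegral_of_isIntegralElem_C {x : L}
    (hx : ((algebraMap k⸨X⸩ L).comp HahnSeries.C).IsIntegralElem x) : IsIntegral k⟦X⟧ x := by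
  obtain ⟨p, hp, hpx⟩ := hx
  refine ⟨p.map PowerSeries.C, hp.map _, ?_⟩
  have h : (algebraMap k⟦X⟧ L).comp PowerSeries.C = (algebraMap k⸨X⸩ L).comp HahnSeries.C := by
    refine RingHom.ext fun d => ?_
    rw [RingHom.comp_apply, IsScalarTower.algebraMap_apply k⟦X⟧ k⸨X⸩ L]
    simp
  rw [Polynomial.eval₂_map, h, hpx]

variable [FiniteDimensional k⸨X⸩ L] [Algebra.IsSeparable k⸨X⸩ L]

/-- Both `x` and `x⁻¹` are algebraic over `k`, hence integral; the convention at zero covers `x =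
0`. -/
theorem ord_eq_zero_of_isIntegralElem_C
    (P : IsDedekindDomain.HeightOneSpectrum (integralClosure k⟦X⟧ L)) {x : L}
    (hx : ((algebraMap k⸨X⸩ L).comp HahnSeries.C).IsIntegralElem x) : ord P x = 0 :=
  ord_eq_zero_of_isIntegral_inv P (isIntegral_of_isIntegralElem_C hx)
    (isIntegral_of_isIntegralElem_C (isIntegralElem_C_inv hx))

/-- Sums of `κ_j π ^ (-j)`: the order is determined by the largest `j`. -/
theorem ord_eval_inv (Q : IntermediateField k⸨X⸩ L)
    (P : IsDedekindDomain.HeightOneSpectrum (integralClosure k⟦X⟧ L)) {π : L} (hπ0 : π ≠ 0)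
    (hπ : 0 < ord P π) (p : Polynomial L) (hp : ∀ n, p.coeff n ∈ residueConstants Q)
    (hp0 : p ≠ 0) : p.eval π⁻¹ ≠ 0 ∧ ord P (p.eval π⁻¹) = -p.natDegree * ord P π := by
  induction hn : p.natDegree using Nat.strong_induction_on generalizing p with
  | _ n ih =>
    have hlead : p.leadingCoeff ≠ 0 := Polynomial.leadingCoeff_ne_zero.mpr hp0
    have hm0 : p.leadingCoeff * π⁻¹ ^ n ≠ 0 := mul_ne_zero hlead (pow_ne_zero _ (inv_ne_zero hπ0))
    have hm : ord P (p.leadingCoeff * π⁻¹ ^ n) = -n * ord P π := by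
      rw [ord_mul P hlead (pow_ne_zero _ (inv_ne_zero hπ0)), ord_pow, ord_inv,
        ord_eq_zero_of_isIntegralElem_C P (x := p.leadingCoeff) (hp _).2]
      ring
    have hev : p.eval π⁻¹ = p.leadingCoeff * π⁻¹ ^ n + p.eraseLead.eval π⁻¹ := by
      conv_lhs => rw [← p.eraseLead_add_C_mul_X_pow]
      simp [hn, add_comm]
    rcases eq_or_ne p.eraseLead 0 with h0 | h0
    · rw [hev, h0, Polynomial.eval_zero, add_zero]
      exact ⟨hm0, hm⟩
    have hlt : p.eraseLead.natDegree < n := by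
      rw [← hn]
      exact (Polynomial.eraseLead_natDegree_lt_or_eraseLead_eq_zero p).resolve_right h0
    obtain ⟨h1, h2⟩ := ih _ hlt p.eraseLead (fun m => by
      rw [Polynomial.eraseLead_coeff]
      split_ifs
      · exact ⟨zero_mem _, RingHom.isIntegralElem_zero _⟩
      · exact hp m) h0 rfl
    rw [hev, ← hm]
    refine ord_add_of_lt P hm0 h1 ?_
    rw [hm, h2]
    have : (p.eraseLead.natDegree : ℤ) < n := by exact_mod_cast hlt
    nlinarith

/-- An element of the Artin–Schreier representatives is either constant or has a pole of order
prime to `3`. -/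
theorem artinSchreierReps_dichotomy (Q : IntermediateField k⸨X⸩ L) {lam π c : L}
    (hlam : lam ∈ residueConstants Q) (hπ0 : π ≠ 0) (hc : c ∈ artinSchreierReps Q lam π) :
    (∃ n : ℤ, c = n • lam) ∨ ∃ j : ℕ, ¬ 3 ∣ j ∧
      ∀ P : IsDedekindDomain.HeightOneSpectrum (integralClosure k⟦X⟧ L), 0 < ord P π →
        ord P c = -j * ord P π := by
  obtain ⟨n, p, h1, h2, rfl⟩ := exists_polynomial_of_mem_artinSchreierReps Q hc
  rcases eq_or_ne p 0 with rfl | hp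
  · exact Or.inl ⟨n, by simp⟩
  have h3 : ¬ 3 ∣ p.natDegree := fun h => hp (Polynomial.leadingCoeff_eq_zero.mp (h2 _ h))
  refine Or.inr ⟨p.natDegree, h3, fun P hP => ?_⟩
  obtain ⟨h4, h5⟩ := ord_eval_inv Q P hπ0 hP p h1 hp
  rcases eq_or_ne (n • lam) 0 with h0 | h0
  · rw [h0, zero_add, h5]
  have h6 : ord P (n • lam) = 0 := by
    refine ord_eq_zero_of_isIntegralElem_C P ?_
    rw [zsmul_eq_mul]
    refine RingHom.IsIntegralElem.mul _ ?_ hlam.2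
    have h7 : (n : L) = ((algebraMap k⸨X⸩ L).comp HahnSeries.C) (n : k) := by simp
    rw [h7]
    exact RingHom.isIntegralElem_map _
  rw [add_comm, ← h5]
  refine (ord_add_of_lt P h4 h0 ?_).2
  rw [h5, h6]
  have : 0 < p.natDegree := Nat.pos_of_ne_zero fun h => h3 (by rw [h]; exact dvd_zero 3)
  have : (0 : ℤ) < p.natDegree := by exact_mod_cast this
  nlinarith

end Constants

/-! ### Squares and an additive polynomial over the finite field. -/

section FiniteField

variable {k : Type*} [Field k] [Finite k] [CharP k 3]

theorem not_isSquare_of_generator {μ : kˣ} (hμ : ∀ x : kˣ, x ∈ Subgroup.zpowers μ) :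
    ¬ IsSquare (μ : k) := by
  have : Fintype k := Fintype.ofFinite k
  rintro ⟨z, hz⟩
  have hz0 : z ≠ 0 := by
    rintro rfl
    simp at hz
  obtain ⟨b, hb⟩ := FiniteField.exists_nonsquare (F := k) (by
    rw [ringChar.eq k 3]; norm_num)
  have hb0 : b ≠ 0 := by
    rintro rfl
    exact hb (IsSquare.zero)
  obtain ⟨n, hn⟩ := Subgroup.mem_zpowers_iff.mp (hμ (Units.mk0 b hb0))
  refine hb ⟨z ^ n, ?_⟩
  have : ((μ ^ n : kˣ) : k) = b := by rw [hn]; rfl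
  rw [← this, Units.val_zpow_eq_zpow_val, hz, mul_zpow]

/-- Over a finite field of characteristic `3`, `d ^ 3 * μ - d` takes all values if `μ` is not a
square. -/
theorem exists_cube_mul_sub {μ : k} (hμ : ¬ IsSquare μ) (c : k) : ∃ d : k, d ^ 3 * μ - d = c := by
  have : Fact (Nat.Prime 3) := ⟨Nat.prime_three⟩
  let f : k →+ k :=
    { toFun := fun d => d ^ 3 * μ - d
      map_zero' := by ring
      map_add' := fun x y => by rw [add_pow_char x y (p := 3)]; ring }
  -- The map is additive, and a nonzero root would give `μ = (d⁻¹)²`; injectivity on a finite set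
  -- yields surjectivity.
  have hf : Function.Injective f := by
    rw [injective_iff_map_eq_zero]
    intro d hd
    by_contra h0
    refine hμ ⟨d⁻¹, ?_⟩
    have h1 : d ^ 3 * μ - d = 0 := hd
    field_simp
    have h2 : d * (d ^ 2 * μ - 1) = 0 := by linear_combination h1
    have h3 := (mul_eq_zero.mp h2).resolve_left h0
    linear_combination h3
  exact Finite.surjective_of_injective hf c

end FiniteField

/-! ### Constants of `k⸨X⸩`. -/

section LaurentConstants

variable {k : Type*} [Field k]

theorem ord_nonneg_of_isIntegral {y : k⸨X⸩} (hy : IsIntegral k⟦X⟧ y) :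
    0 ≤ ord (PowerSeries.idealX k) y := by
  obtain ⟨r, rfl⟩ := IsIntegrallyClosed.isIntegral_iff.mp hy
  exact ord_algebraMap_nonneg _ r

/-- The elements of `k⸨X⸩` which are algebraic over `k` are constants. -/
theorem eq_C_of_isIntegralElem {y : k⸨X⸩}
    (hy : (HahnSeries.C : k →+* k⸨X⸩).IsIntegralElem y) : ∃ d : k, y = HahnSeries.C d := by
  have key : ∀ z : k⸨X⸩, (HahnSeries.C : k →+* k⸨X⸩).IsIntegralElem z →
      0 ≤ ord (PowerSeries.idealX k) z ∧ ord (PowerSeries.idealX k) z ≤ 0 := by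
    intro z hz
    have hz' : ((algebraMap k⸨X⸩ k⸨X⸩).comp HahnSeries.C).IsIntegralElem z := hz
    have h1 := ord_nonneg_of_isIntegral (isIntegral_of_isIntegralElem_C hz')
    have h2 := ord_nonneg_of_isIntegral (isIntegral_of_isIntegralElem_C (isIntegralElem_C_inv hz'))
    rw [ord_inv] at h2
    exact ⟨h1, by omega⟩
  obtain ⟨r, rfl⟩ := exists_algebraMap_of_ord_nonneg (key y hy).1
  refine ⟨PowerSeries.constantCoeff r, ?_⟩
  by_contra hne
  have h1 : (HahnSeries.C (PowerSeries.constantCoeff r) : k⸨X⸩) =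
      algebraMap k⟦X⟧ k⸨X⸩ (PowerSeries.C (PowerSeries.constantCoeff r)) := by simp
  obtain ⟨s, hs⟩ : PowerSeries.X ∣ r - PowerSeries.C (PowerSeries.constantCoeff r) := by
    rw [PowerSeries.X_dvd_iff]; simp
  have h2 := (key _ (RingHom.IsIntegralElem.sub _ hy (RingHom.isIntegralElem_map _ (x :=
    PowerSeries.constantCoeff r)))).2
  have h3 : algebraMap k⟦X⟧ k⸨X⸩ r - HahnSeries.C (PowerSeries.constantCoeff r) =
      algebraMap k⟦X⟧ k⸨X⸩ PowerSeries.X * algebraMap k⟦X⟧ k⸨X⸩ s := by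
    rw [h1, ← map_sub, hs, map_mul]
  have h4 := sub_ne_zero.mpr hne
  rw [h3] at h4 h2
  rw [ord_mul _ (left_ne_zero_of_mul h4) (right_ne_zero_of_mul h4), ord_idealX_X] at h2
  have := ord_algebraMap_nonneg (F := k⸨X⸩) (PowerSeries.idealX k) s
  omega

end LaurentConstants

/-! ### Integers, units and constants of the quadratic extension `Q`. -/

section Quadratic

theorem three_eq_zero (k : Type*) [Field k] [CharP k 3] {L : Type*} [Field L]
    [Algebra k⸨X⸩ L] : (3 : L) = 0 := by
  have : CharP k⸨X⸩ 3 := charP_of_injective_ringHom (HahnSeries.C (Γ := ℤ) (R := k)).injective 3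
  have : CharP L 3 := charP_of_injective_algebraMap (algebraMap k⸨X⸩ L).injective 3
  exact_mod_cast CharP.cast_eq_zero L 3

variable {k : Type*} [Field k] {L : Type*} [Field L] [Algebra k⸨X⸩ L] [Algebra k⟦X⟧ L]
  [IsScalarTower k⟦X⟧ k⸨X⸩ L]

theorem isIntegral_algebraMap_laurent_iff {c : k⸨X⸩} :
    IsIntegral k⟦X⟧ (algebraMap k⸨X⸩ L c) ↔ IsIntegral k⟦X⟧ c :=
  isIntegral_algebraMap_iff (algebraMap k⸨X⸩ L).injective

/-- The integers of a quadratic extension with square root `α` of `a`, `v(a) ≤ 1`. -/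
theorem exists_integral_coordinates [CharP k 3] {a : k⸨X⸩} (ha0 : a ≠ 0)
    (ha : ord (PowerSeries.idealX k) a ≤ 1) {α : L}
    (hα : α ^ 2 = algebraMap k⸨X⸩ L a) (τ : L →ₐ[k⸨X⸩] L) (hτα : τ α = -α) {x : L}
    (hx : x ∈ k⸨X⸩⟮α⟯) (hint : IsIntegral k⟦X⟧ x) :
    ∃ r s : k⟦X⟧, x = algebraMap k⟦X⟧ L r + algebraMap k⟦X⟧ L s * α := by
  have h3 : (3 : L) = 0 := three_eq_zero k
  obtain ⟨c, d, rfl⟩ := exists_add_mul_of_mem_adjoin hα hx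
  have hτ := hint.map (τ.restrictScalars k⟦X⟧)
  have hτ' : (τ.restrictScalars k⟦X⟧) (algebraMap k⸨X⸩ L c + algebraMap k⸨X⸩ L d * α) =
      algebraMap k⸨X⸩ L c - algebraMap k⸨X⸩ L d * α := by
    change τ _ = _
    simp [hτα, sub_eq_add_neg]
  rw [hτ'] at hτ
  -- In characteristic `3` the trace `x + τ x = 2c` is `-c`, and `x - τ x = 2dα` is `-dα`, whose
  -- square is `d² a`.
  have hc : IsIntegral k⟦X⟧ (algebraMap k⸨X⸩ L c) := by
    have h : algebraMap k⸨X⸩ L c = -(algebraMap k⸨X⸩ L c + algebraMap k⸨X⸩ L d * α +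
        (algebraMap k⸨X⸩ L c - algebraMap k⸨X⸩ L d * α)) := by
      linear_combination (algebraMap k⸨X⸩ L c) * h3
    rw [h]
    exact (hint.add hτ).neg
  have hd : IsIntegral k⟦X⟧ (algebraMap k⸨X⸩ L (d ^ 2 * a)) := by
    have h : algebraMap k⸨X⸩ L (d ^ 2 * a) = (algebraMap k⸨X⸩ L c + algebraMap k⸨X⸩ L d * α -
        (algebraMap k⸨X⸩ L c - algebraMap k⸨X⸩ L d * α)) ^ 2 := by
      rw [map_mul, map_pow, ← hα]
      linear_combination -(algebraMap k⸨X⸩ L d) ^ 2 * α ^ 2 * h3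
    rw [h]
    exact (hint.sub hτ).pow 2
  obtain ⟨r, rfl⟩ := exists_algebraMap_of_ord_nonneg
    (ord_nonneg_of_isIntegral (isIntegral_algebraMap_laurent_iff.mp hc))
  -- From `2 v(d) + v(a) ≥ 0` and `v(a) ≤ 1` one gets `2 v(d) ≥ -1`, hence `v(d) ≥ 0`.
  have hd' : 0 ≤ ord (PowerSeries.idealX k) d := by
    rcases eq_or_ne d 0 with rfl | hd0
    · rw [ord_zero]
    have := ord_nonneg_of_isIntegral (isIntegral_algebraMap_laurent_iff.mp hd)
    rw [ord_mul _ (pow_ne_zero _ hd0) ha0, ord_pow] at this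
    push_cast at this
    omega
  obtain ⟨s, rfl⟩ := exists_algebraMap_of_ord_nonneg hd'
  exact ⟨r, s, by simp only [← IsScalarTower.algebraMap_apply]⟩

/-- The inverse is the conjugate divided by the norm `r² - s² a'`, a unit of `k⟦X⟧`. -/
theorem isIntegral_inv_of_norm {k L : Type*} [Field k] [Field L] [Algebra k⟦X⟧ L] {a' : k⟦X⟧} {α : L} (hα : α ^ 2 = algebraMap k⟦X⟧ L a') {r s : k⟦X⟧}
    (h : PowerSeries.constantCoeff (r ^ 2 - s ^ 2 * a') ≠ 0) :
    IsIntegral k⟦X⟧ (algebraMap k⟦X⟧ L r + algebraMap k⟦X⟧ L s * α)⁻¹ := by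
  have hαint : IsIntegral k⟦X⟧ α :=
    .of_pow (n := 2) (by norm_num) (by rw [hα]; exact isIntegral_algebraMap)
  obtain ⟨u, hu⟩ := PowerSeries.isUnit_iff_constantCoeff.mpr h.isUnit
  have h1 : (algebraMap k⟦X⟧ L r + algebraMap k⟦X⟧ L s * α)⁻¹ =
      algebraMap k⟦X⟧ L ((u⁻¹ : k⟦X⟧ˣ) : k⟦X⟧) *
        (algebraMap k⟦X⟧ L r - algebraMap k⟦X⟧ L s * α) := by
    refine inv_eq_of_mul_eq_one_left ?_
    have h2 : algebraMap k⟦X⟧ L ((u⁻¹ : k⟦X⟧ˣ) : k⟦X⟧) * algebraMap k⟦X⟧ L (r ^ 2 - s ^ 2 * a') = 1 := by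
      rw [← hu, ← map_mul]; simp
    rw [← h2]
    simp only [map_sub, map_mul, map_pow, ← hα]
    ring
  rw [h1]
  exact isIntegral_algebraMap.mul (isIntegral_algebraMap.sub (isIntegral_algebraMap.mul hαint))

/-- Irreducibility lives in the integers of `Q`, whereas orders are taken at primes of `L`; this
transports it to elements of `L`. -/
theorem isIntegral_inv_or_of_irreducible (Q : IntermediateField k⸨X⸩ L)
    {π : integralClosure k⟦X⟧ Q} (hπ : Irreducible π) {x y : L} (hxQ : x ∈ Q) (hyQ : y ∈ Q)
    (hx : IsIntegral k⟦X⟧ x) (hy : IsIntegral k⟦X⟧ y) (hxy : ((π : Q) : L) = x * y) :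
    IsIntegral k⟦X⟧ x⁻¹ ∨ IsIntegral k⟦X⟧ y⁻¹ := by
  have hQ : ∀ z : Q, IsIntegral k⟦X⟧ (z : L) ↔ IsIntegral k⟦X⟧ z := fun z =>
    isIntegral_algHom_iff (Q.val.restrictScalars k⟦X⟧) Subtype.val_injective
  have hunit : ∀ u : integralClosure k⟦X⟧ Q, IsUnit u → IsIntegral k⟦X⟧ (((u : Q) : L)⁻¹) := by
    rintro _ ⟨u, rfl⟩
    have h1 : (((u : integralClosure k⟦X⟧ Q) : Q) : L)⁻¹ =
        ((((u⁻¹ : (integralClosure k⟦X⟧ Q)ˣ) : integralClosure k⟦X⟧ Q) : Q) : L) := by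
      refine inv_eq_of_mul_eq_one_left ?_
      exact congrArg (fun z : integralClosure k⟦X⟧ Q => ((z : Q) : L)) u.inv_mul
    rw [h1, hQ]
    exact (((u⁻¹ : (integralClosure k⟦X⟧ Q)ˣ) : integralClosure k⟦X⟧ Q)).2
  let x' : integralClosure k⟦X⟧ Q := ⟨⟨x, hxQ⟩, (hQ ⟨x, hxQ⟩).mp hx⟩
  let y' : integralClosure k⟦X⟧ Q := ⟨⟨y, hyQ⟩, (hQ ⟨y, hyQ⟩).mp hy⟩
  have hxy' : π = x' * y' := Subtype.ext (Subtype.ext hxy)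
  exact (hπ.isUnit_or_isUnit hxy').imp (hunit x') (hunit y')

theorem not_isIntegral_inv_of_irreducible (Q : IntermediateField k⸨X⸩ L)
    {π : integralClosure k⟦X⟧ Q} (hπ : Irreducible π) :
    IsIntegral k⟦X⟧ ((π : Q) : L) ∧ ((π : Q) : L) ≠ 0 ∧ ¬ IsIntegral k⟦X⟧ ((π : Q) : L)⁻¹ := by
  have hQ : ∀ z : Q, IsIntegral k⟦X⟧ (z : L) ↔ IsIntegral k⟦X⟧ z := fun z =>
    isIntegral_algHom_iff (Q.val.restrictScalars k⟦X⟧) Subtype.val_injective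
  have hne : ((π : Q) : L) ≠ 0 := fun h => hπ.ne_zero (Subtype.ext (Subtype.ext h))
  refine ⟨(hQ _).mpr π.2, hne, fun h => hπ.not_isUnit ?_⟩
  have h1 : IsIntegral k⟦X⟧ ((π : Q)⁻¹) := (hQ _).mp h
  refine IsUnit.of_mul_eq_one ⟨(π : Q)⁻¹, h1⟩ (Subtype.ext ?_)
  exact mul_inv_cancel₀ fun h0 => hne (congrArg Subtype.val h0)

end Quadratic

theorem eq_algebraMap_mul_of_anti_invariant {k : Type*} [Field k] [CharP k 3] {L : Type*} [Field L]
    [Algebra k⸨X⸩ L] {a : k⸨X⸩} {α x : L}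
    (hα : α ^ 2 = algebraMap k⸨X⸩ L a) (τ : L →ₐ[k⸨X⸩] L) (hτα : τ α = -α)
    (hx : x ∈ k⸨X⸩⟮α⟯) (hτx : τ x = -x) : ∃ y : k⸨X⸩, x = algebraMap k⸨X⸩ L y * α := by
  have h3 : (3 : L) = 0 := three_eq_zero k
  obtain ⟨c, d, rfl⟩ := exists_add_mul_of_mem_adjoin hα hx
  simp only [map_add, map_mul, AlgHom.commutes, hτα] at hτx
  refine ⟨d, ?_⟩
  linear_combination algebraMap k⸨X⸩ L c * h3 - hτx

/-- A nonzero constant of `Q` of the unramified extension that is anti-invariant is of the form `κ ^ 3 - κ`. -/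
theorem exists_cube_sub_of_anti_invariant {k : Type*} [Field k] [Finite k] [CharP k 3]
    {L : Type*} [Field L] [Algebra k⸨X⸩ L] {μ : k} (hμ : ¬ IsSquare μ) {α : L}
    (hα : α ^ 2 = algebraMap k⸨X⸩ L (HahnSeries.C μ)) (τ : L →ₐ[k⸨X⸩] L) (hτα : τ α = -α)
    (Q : IntermediateField k⸨X⸩ L) (hαQ : k⸨X⸩⟮α⟯ = Q) {lam : L} (hlam : lam ∈ residueConstants Q)
    (hτ : τ lam = -lam) : ∃ κ ∈ residueConstants Q, κ ^ 3 - κ = lam := by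
  obtain ⟨y, rfl⟩ := eq_algebraMap_mul_of_anti_invariant hα τ hτα (by rw [hαQ]; exact hlam.1) hτ
  let f : k →+* L := (algebraMap k⸨X⸩ L).comp HahnSeries.C
  have hμ0 : μ ≠ 0 := by
    rintro rfl
    exact hμ IsSquare.zero
  have hα0 : α ≠ 0 := by
    rintro rfl
    have h0 : algebraMap k⸨X⸩ L (HahnSeries.C μ) = 0 := by rw [← hα]; ring
    exact hμ0 (by simpa using h0)
  have hαint : f.IsIntegralElem α := by
    refine ⟨Polynomial.X ^ 2 - Polynomial.C μ, Polynomial.monic_X_pow_sub_C _ (by norm_num), ?_⟩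
    simp [f, hα]
  have hyint : f.IsIntegralElem (algebraMap k⸨X⸩ L y) := by
    have := RingHom.IsIntegralElem.mul _ hlam.2 (isIntegralElem_C_inv hαint)
    rwa [mul_assoc, mul_inv_cancel₀ hα0, mul_one] at this
  obtain ⟨p, hp, hpy⟩ := hyint
  obtain ⟨d, rfl⟩ := eq_C_of_isIntegralElem (y := y) ⟨p, hp, by
    rw [← Polynomial.hom_eval₂] at hpy
    exact (map_eq_zero _).mp hpy⟩
  -- The witness is `κ = eα`: since `α² = μ`, `κ³ - κ = (e³ μ - e) α = d α`.
  obtain ⟨e, he⟩ := exists_cube_mul_sub hμ d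
  refine ⟨f e * α, ⟨mul_mem (Q.algebraMap_mem _) ?_, RingHom.IsIntegralElem.mul _
    (RingHom.isIntegralElem_map _) hαint⟩, ?_⟩
  · rw [← hαQ]; exact IntermediateField.mem_adjoin_simple_self _ _
  · have h1 : f d = f e ^ 3 * f μ - f e := by rw [← he]; simp
    have h2 : α ^ 2 = f μ := hα
    change _ = f d * α
    rw [h1]
    linear_combination f e ^ 3 * α * h2

/-! ### Orders of `π`, `α` and `β` at the primes of `L`. -/

section LocalData

open IsDedekindDomain

variable {k : Type*} [Field k] {L : Type*} [Field L] [Algebra k⸨X⸩ L]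
    [Algebra k⟦X⟧ L] [IsScalarTower k⟦X⟧ k⸨X⸩ L] [FiniteDimensional k⸨X⸩ L]
    [Algebra.IsSeparable k⸨X⸩ L]

theorem ord_sq_root (P : HeightOneSpectrum (integralClosure k⟦X⟧ L)) {a : k⸨X⸩} {α : L}
    (hα : α ^ 2 = algebraMap k⸨X⸩ L a) :
    2 * ord P α = P.asIdeal.ramificationIdx k⟦X⟧ * ord (PowerSeries.idealX k) a := by
  have h := ord_pow P α 2
  rw [hα, ord_algebraMap] at h
  exact_mod_cast h.symm

/-- A uniformizer of the unramified quadratic extension has the order of `t`. -/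
theorem ord_uniformizer_of_unit [CharP k 3] {μ : k} (hμ : ¬ IsSquare μ) {α : L}
    (hα : α ^ 2 = algebraMap k⸨X⸩ L (HahnSeries.C μ)) (τ : L →ₐ[k⸨X⸩] L) (hτα : τ α = -α)
    (Q : IntermediateField k⸨X⸩ L) (hαQ : k⸨X⸩⟮α⟯ = Q) {π : integralClosure k⟦X⟧ Q}
    (hπ : Irreducible π) (P : HeightOneSpectrum (integralClosure k⟦X⟧ L)) :
    ord P ((π : Q) : L) = P.asIdeal.ramificationIdx k⟦X⟧ := by
  have hμ0 : μ ≠ 0 := by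
    rintro rfl
    exact hμ IsSquare.zero
  obtain ⟨hint, hne, hninv⟩ := not_isIntegral_inv_of_irreducible Q hπ
  have hC0 : (HahnSeries.C μ : k⸨X⸩) ≠ 0 := (map_ne_zero _).mpr hμ0
  obtain ⟨r, s, hrs⟩ := exists_integral_coordinates hC0 (by rw [ord_idealX_C]; norm_num) hα τ hτα
    (by rw [hαQ]; exact (π : Q).2) hint
  have hα' : α ^ 2 = algebraMap k⟦X⟧ L (PowerSeries.C μ) := by
    rw [hα, IsScalarTower.algebraMap_apply k⟦X⟧ k⸨X⸩ L]
    simp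
  have hαint : IsIntegral k⟦X⟧ α :=
    .of_pow (n := 2) (by norm_num) (by rw [hα']; exact isIntegral_algebraMap)
  have hzero : PowerSeries.constantCoeff (r ^ 2 - s ^ 2 * PowerSeries.C μ) = 0 := by
    by_contra h
    exact hninv (by rw [hrs]; exact isIntegral_inv_of_norm hα' h)
  simp only [map_sub, map_mul, map_pow, PowerSeries.constantCoeff_C] at hzero
  -- Otherwise the vanishing of the norm modulo `X` exhibits `μ` as a square.
  have hs : PowerSeries.constantCoeff s = 0 := by
    by_contra h
    refine hμ ⟨PowerSeries.constantCoeff r / PowerSeries.constantCoeff s, ?_⟩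
    field_simp
    linear_combination -hzero
  have hr : PowerSeries.constantCoeff r = 0 := by
    rw [hs] at hzero
    simpa using hzero
  obtain ⟨r', rfl⟩ := PowerSeries.X_dvd_iff.mpr hr
  obtain ⟨s', rfl⟩ := PowerSeries.X_dvd_iff.mpr hs
  have hX : ord P (algebraMap k⟦X⟧ L PowerSeries.X) = P.asIdeal.ramificationIdx k⟦X⟧ := by
    rw [IsScalarTower.algebraMap_apply k⟦X⟧ k⸨X⸩ L, ord_algebraMap, ord_idealX_X, mul_one]
  have hfac : ((π : Q) : L) = algebraMap k⟦X⟧ L PowerSeries.X *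
      (algebraMap k⟦X⟧ L r' + algebraMap k⟦X⟧ L s' * α) := by
    rw [hrs, map_mul, map_mul]; ring
  have hmem : ∀ r : k⟦X⟧, algebraMap k⟦X⟧ L r ∈ Q := fun r => by
    rw [IsScalarTower.algebraMap_apply k⟦X⟧ k⸨X⸩ L]; exact Q.algebraMap_mem _
  have hαmem : α ∈ Q := by rw [← hαQ]; exact IntermediateField.mem_adjoin_simple_self _ _
  have hyint : IsIntegral k⟦X⟧ (algebraMap k⟦X⟧ L r' + algebraMap k⟦X⟧ L s' * α) :=
    isIntegral_algebraMap.add (isIntegral_algebraMap.mul hαint)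
  have hprod := hne
  rw [hfac] at hprod
  -- In `π = X * y` one factor is a unit, and it is not `X`, whose order is `e > 0`.
  rcases isIntegral_inv_or_of_irreducible Q hπ (hmem _) (add_mem (hmem _) (mul_mem (hmem _) hαmem))
    isIntegral_algebraMap hyint hfac with h | h
  · have := ord_eq_zero_of_isIntegral_inv P isIntegral_algebraMap h
    have := ramificationIdx_pos P
    omega
  · rw [hfac, ord_mul P (left_ne_zero_of_mul hprod) (right_ne_zero_of_mul hprod), hX,
      ord_eq_zero_of_isIntegral_inv P hyint h, add_zero]

/-- A uniformizer of a ramified quadratic extension has the order of the square root of `t`. -/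
theorem ord_uniformizer_of_ramified [CharP k 3] {c : k} (hc : c ≠ 0) {α : L}
    (hα : α ^ 2 = algebraMap k⸨X⸩ L (HahnSeries.C c * algebraMap k⟦X⟧ k⸨X⸩ PowerSeries.X))
    (τ : L →ₐ[k⸨X⸩] L) (hτα : τ α = -α)
    (Q : IntermediateField k⸨X⸩ L) (hαQ : k⸨X⸩⟮α⟯ = Q) {π : integralClosure k⟦X⟧ Q}
    (hπ : Irreducible π) (P : HeightOneSpectrum (integralClosure k⟦X⟧ L)) :
    ord P ((π : Q) : L) = ord P α := by
  obtain ⟨hint, hne, hninv⟩ := not_isIntegral_inv_of_irreducible Q hπ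
  have hC0 : (HahnSeries.C c : k⸨X⸩) ≠ 0 := (map_ne_zero _).mpr hc
  have hX0 : algebraMap k⟦X⟧ k⸨X⸩ PowerSeries.X ≠ 0 := by simp
  have horda : ord (PowerSeries.idealX k)
      (HahnSeries.C c * algebraMap k⟦X⟧ k⸨X⸩ PowerSeries.X) = 1 := by
    rw [ord_mul _ hC0 hX0, ord_idealX_C, ord_idealX_X, zero_add]
  obtain ⟨r, s, hrs⟩ := exists_integral_coordinates (mul_ne_zero hC0 hX0) horda.le hα τ hτα
    (by rw [hαQ]; exact (π : Q).2) hint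
  have hα' : α ^ 2 = algebraMap k⟦X⟧ L (PowerSeries.C c * PowerSeries.X) := by
    rw [hα, IsScalarTower.algebraMap_apply k⟦X⟧ k⸨X⸩ L]
    simp
  have hαint : IsIntegral k⟦X⟧ α :=
    .of_pow (n := 2) (by norm_num) (by rw [hα']; exact isIntegral_algebraMap)
  have hr : PowerSeries.constantCoeff r = 0 := by
    by_contra h
    refine hninv ?_
    rw [hrs]
    refine isIntegral_inv_of_norm hα' ?_
    simpa using h
  obtain ⟨r', rfl⟩ := PowerSeries.X_dvd_iff.mpr hr
  -- Since `X = c⁻¹ α²`, the term `X r'` is divisible by `α` as well.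
  have hfac : ((π : Q) : L) = α *
      (algebraMap k⟦X⟧ L s + algebraMap k⟦X⟧ L (r' * PowerSeries.C c⁻¹) * α) := by
    have h1 : (PowerSeries.C c⁻¹ * PowerSeries.C c : k⟦X⟧) = 1 := by
      rw [← map_mul, inv_mul_cancel₀ hc, map_one]
    have h2 : algebraMap k⟦X⟧ L (PowerSeries.X * r') =
        algebraMap k⟦X⟧ L (r' * PowerSeries.C c⁻¹) * α ^ 2 := by
      rw [hα', ← map_mul]
      congr 1
      linear_combination (-(r' * PowerSeries.X)) * h1
    rw [hrs, h2]; ring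
  have hmem : ∀ r : k⟦X⟧, algebraMap k⟦X⟧ L r ∈ Q := fun r => by
    rw [IsScalarTower.algebraMap_apply k⟦X⟧ k⸨X⸩ L]; exact Q.algebraMap_mem _
  have hαmem : α ∈ Q := by rw [← hαQ]; exact IntermediateField.mem_adjoin_simple_self _ _
  have hyint : IsIntegral k⟦X⟧
      (algebraMap k⟦X⟧ L s + algebraMap k⟦X⟧ L (r' * PowerSeries.C c⁻¹) * α) :=
    isIntegral_algebraMap.add (isIntegral_algebraMap.mul hαint)
  have hprod := hne
  rw [hfac] at hprod
  rcases isIntegral_inv_or_of_irreducible Q hπ hαmem (add_mem (hmem _) (mul_mem (hmem _) hαmem))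
    hαint hyint hfac with h | h
  · have h1 := ord_eq_zero_of_isIntegral_inv P hαint h
    have h2 := ord_sq_root P hα
    rw [h1, horda] at h2
    have := ramificationIdx_pos P
    omega
  · rw [hfac, ord_mul P (left_ne_zero_of_mul hprod) (right_ne_zero_of_mul hprod),
      ord_eq_zero_of_isIntegral_inv P hyint h, add_zero]

/-- If `β ^ 3 - β` has a pole of order `m`, then `β` has a pole of order `m / 3`. -/
theorem three_mul_ord_of_artinSchreier (P : HeightOneSpectrum (integralClosure k⟦X⟧ L)) {β : L}
    (h : ord P (β ^ 3 - β) < 0) : 3 * ord P β = ord P (β ^ 3 - β) := by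
  have hβ0 : β ≠ 0 := by
    rintro rfl
    norm_num [ord_zero] at h
  have h3 : ord P (β ^ 3) = 3 * ord P β := by rw [ord_pow]; norm_num
  have hneg : ord P β < 0 := by
    by_contra hβ
    push Not at hβ
    refine absurd ?_ (not_le.mpr h)
    rw [sub_eq_add_neg]
    exact ord_add_nonneg P (by omega) (by rwa [ord_neg])
  rw [sub_eq_add_neg, (ord_add_of_lt P (pow_ne_zero 3 hβ0) (neg_ne_zero.mpr hβ0)
    (by rw [h3, ord_neg]; omega)).2, h3]

theorem eq_zero_of_anti_invariant_of_ramified [CharP k 3] {a : k⸨X⸩}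
    (ha : ord (PowerSeries.idealX k) a = 1) {α : L}
    (hα : α ^ 2 = algebraMap k⸨X⸩ L a) (τ : L →ₐ[k⸨X⸩] L) (hτα : τ α = -α)
    (Q : IntermediateField k⸨X⸩ L) (hαQ : k⸨X⸩⟮α⟯ = Q) {lam : L} (hlam : lam ∈ residueConstants Q)
    (hτ : τ lam = -lam) (P : HeightOneSpectrum (integralClosure k⟦X⟧ L)) : lam = 0 := by
  obtain ⟨y, rfl⟩ := eq_algebraMap_mul_of_anti_invariant hα τ hτα (by rw [hαQ]; exact hlam.1) hτ
  by_contra h0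
  have h1 := ord_eq_zero_of_isIntegralElem_C P hlam.2
  rw [ord_mul P (left_ne_zero_of_mul h0) (right_ne_zero_of_mul h0), ord_algebraMap] at h1
  have h2 := ord_sq_root P hα
  rw [ha, mul_one] at h2
  have h3 := ramificationIdx_pos P
  -- A parity contradiction: a nonzero multiple of `α` by an element of `K` has order `e (2 v(y) +
  -- 1) / 2`, which is never zero.
  have h4 : (P.asIdeal.ramificationIdx k⟦X⟧ : ℤ) * (2 * ord (PowerSeries.idealX k) y + 1) = 0 := by
    linear_combination 2 * h1 - h2
  rcases mul_eq_zero.mp h4 with h | h <;> omega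

end LocalData

/-! ### Ramification of `L` and its integral anti-invariants. -/

section ArtinSchreierExtension

open IsDedekindDomain

variable {k : Type*} [Field k] {L : Type*} [Field L] [Algebra k⸨X⸩ L]
    [Algebra k⟦X⟧ L] [IsScalarTower k⟦X⟧ k⸨X⸩ L] [FiniteDimensional k⸨X⸩ L]
    [Algebra.IsSeparable k⸨X⸩ L]

/-- The Artin–Schreier class of a generator on which `τ` acts by `-1` is not constant. -/
theorem not_constant_artinSchreier [Finite k] [CharP k 3] {μ : k} (hμ : ¬ IsSquare μ) {a : k⸨X⸩}
    (ha : a = HahnSeries.C μ ∨ ord (PowerSeries.idealX k) a = 1) {α : L}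
    (hα : α ^ 2 = algebraMap k⸨X⸩ L a) (σ τ : L →ₐ[k⸨X⸩] L) (hτα : τ α = -α)
    (Q : IntermediateField k⸨X⸩ L) (hαQ : k⸨X⸩⟮α⟯ = Q) {lam : L} (hlam : lam ∈ residueConstants Q)
    (hlam' : ∀ κ ∈ residueConstants Q, κ ^ 3 - κ ≠ lam) {β : L} (hσβ : σ β = β + 1)
    (hτβ : τ β = -β) (P : HeightOneSpectrum (integralClosure k⟦X⟧ L)) (n : ℤ) :
    β ^ 3 - β ≠ n • lam := by
  intro hn
  have h3 : (3 : L) = 0 := three_eq_zero k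
  -- The roots of `z³ - z` lie in the prime field, which `σ` fixes, while `σ β = β + 1`.
  have hne : β ^ 3 - β ≠ 0 := by
    intro h0
    have h1 : β * ((β - 1) * (β + 1)) = 0 := by linear_combination h0
    have key : ∀ m : ℤ, β ≠ m := by
      rintro m rfl
      rw [map_intCast] at hσβ
      exact one_ne_zero (left_eq_add.mp hσβ)
    rcases mul_eq_zero.mp h1 with h | h
    · exact key 0 (by simpa using h)
    rcases mul_eq_zero.mp h with h | h
    · exact key 1 (by push_cast; linear_combination h)
    · exact key (-1) (by push_cast; linear_combination h)
  have hτ : τ lam = -lam := by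
    have h1 : τ (n • lam) = -(n • lam) := by
      rw [← hn]
      simp only [map_sub, map_pow, hτβ]
      ring
    rw [map_zsmul, ← smul_neg, zsmul_eq_mul, zsmul_eq_mul] at h1
    refine mul_left_cancel₀ (fun h0 => hne ?_) h1
    rw [hn, zsmul_eq_mul, h0, zero_mul]
  rcases ha with rfl | ha
  · obtain ⟨κ, hκ, hκ'⟩ := exists_cube_sub_of_anti_invariant hμ hα τ hτα Q hαQ hlam hτ
    exact hlam' κ hκ hκ'
  · refine hne ?_
    rw [hn, eq_zero_of_anti_invariant_of_ramified ha hα τ hτα Q hαQ hlam hτ P, smul_zero]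

/-- Ramification of the Artin–Schreier extension: ramification index and orders of `α` and `β` are
the same at all primes. -/
theorem exists_ramification_data [Finite k] [CharP k 3] {μ : k} (hμ : ¬ IsSquare μ) {a : k⸨X⸩}
    (ha : a = HahnSeries.C μ ∨ ∃ c : k, c ≠ 0 ∧
      a = HahnSeries.C c * algebraMap k⟦X⟧ k⸨X⸩ PowerSeries.X) {α : L}
    (hα : α ^ 2 = algebraMap k⸨X⸩ L a) (σ τ : L →ₐ[k⸨X⸩] L) (hτα : τ α = -α)
    (Q : IntermediateField k⸨X⸩ L) (hαQ : k⸨X⸩⟮α⟯ = Q) {π : integralClosure k⟦X⟧ Q}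
    (hπ : Irreducible π) {lam : L} (hlam : lam ∈ residueConstants Q)
    (hlam' : ∀ κ ∈ residueConstants Q, κ ^ 3 - κ ≠ lam) {β : L}
    (hβ : β ^ 3 - β ∈ artinSchreierReps Q lam ((π : Q) : L)) (hσβ : σ β = β + 1)
    (hτβ : τ β = -β) (hL : Module.finrank k⸨X⸩ L ≤ 6)
    (P₀ : HeightOneSpectrum (integralClosure k⟦X⟧ L)) :
    ∃ j : ℕ, ¬ 3 ∣ j ∧
      ((a = HahnSeries.C μ ∧ ord (PowerSeries.idealX k) a = 0 ∧
        ∀ P : HeightOneSpectrum (integralClosure k⟦X⟧ L),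
          ord P β = -j ∧ P.asIdeal.ramificationIdx k⟦X⟧ = 3 ∧ ord P α = 0) ∨
      (a ≠ HahnSeries.C μ ∧ ord (PowerSeries.idealX k) a = 1 ∧
        ∀ P : HeightOneSpectrum (integralClosure k⟦X⟧ L),
          ord P β = -j ∧ P.asIdeal.ramificationIdx k⟦X⟧ = 6 ∧ ord P α = 3)) := by
  have ha' : a = HahnSeries.C μ ∨ ord (PowerSeries.idealX k) a = 1 := by
    refine ha.imp_right ?_
    rintro ⟨c, hc, rfl⟩
    rw [ord_mul _ ((map_ne_zero _).mpr hc) (by simp), ord_idealX_C, ord_idealX_X, zero_add]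
  have hnc := not_constant_artinSchreier hμ ha' hα σ τ hτα Q hαQ hlam hlam' hσβ hτβ P₀
  obtain ⟨hπint, hπ0, -⟩ := not_isIntegral_inv_of_irreducible Q hπ
  rcases artinSchreierReps_dichotomy Q hlam hπ0 hβ with ⟨n, hn⟩ | ⟨j, hj3, hj⟩
  · exact absurd hn (hnc n)
  have hj0 : 0 < j := Nat.pos_of_ne_zero fun h => hj3 (by rw [h]; exact dvd_zero 3)
  have hβord : ∀ P : HeightOneSpectrum (integralClosure k⟦X⟧ L), 0 < ord P ((π : Q) : L) →
      3 * ord P β = -j * ord P ((π : Q) : L) := by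
    intro P hP
    rw [← hj P hP]
    refine three_mul_ord_of_artinSchreier P ?_
    rw [hj P hP]
    have : (0 : ℤ) < j := by exact_mod_cast hj0
    nlinarith
  -- As `3 ∤ j`, the factor `3` must divide the order of `π`; this is what makes the cubic step
  -- ramify.
  have hdvd : ∀ x y : ℤ, 3 * x = -j * y → 3 ∣ y := by
    intro x y hxy
    have h1 : (3 : ℤ) ∣ j * y := ⟨-x, by linear_combination hxy⟩
    refine (Int.Prime.dvd_mul' Nat.prime_three h1).resolve_left fun h => hj3 ?_
    exact_mod_cast h
  refine ⟨j, hj3, ?_⟩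
  rcases ha with rfl | ⟨c, hc, rfl⟩
  · left
    refine ⟨rfl, ord_idealX_C, fun P => ?_⟩
    have hπe := ord_uniformizer_of_unit hμ hα τ hτα Q hαQ hπ P
    have he0 := ramificationIdx_pos P
    have hb := hβord P (by rw [hπe]; exact_mod_cast he0)
    rw [hπe] at hb
    have h3 := hdvd _ _ hb
    have hef := ramificationIdx_mul_inertiaDeg_le P
    have hf0 := inertiaDeg_pos P
    have hf1 := inertiaDeg_ne_one_of_sq P hμ hα
    -- The square root of `μ` forces `f ≥ 2`, so `e f ≤ 6` leaves `e ≤ 3`, while `3 ∣ e`.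
    have hf2 : 2 ≤ P.asIdeal.inertiaDeg k⟦X⟧ := by omega
    have he : P.asIdeal.ramificationIdx k⟦X⟧ ≤ 3 := by nlinarith
    have he3 : P.asIdeal.ramificationIdx k⟦X⟧ = 3 := by omega
    have hαo := ord_sq_root P hα
    rw [ord_idealX_C] at hαo
    rw [he3] at hb
    exact ⟨by push_cast at hb; omega, he3, by omega⟩
  · right
    have horda := ha'.resolve_left (by
      intro h
      have h1 : ord (PowerSeries.idealX k) (HahnSeries.C c *
        algebraMap k⟦X⟧ k⸨X⸩ PowerSeries.X) = 0 := by rw [h, ord_idealX_C]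
      rw [ord_mul _ ((map_ne_zero _).mpr hc) (by simp), ord_idealX_C, ord_idealX_X] at h1
      norm_num at h1)
    refine ⟨fun h => ?_, horda, fun P => ?_⟩
    · rw [h, ord_idealX_C] at horda
      norm_num at horda
    have hπe := ord_uniformizer_of_ramified hc hα τ hτα Q hαQ hπ P
    have he0 := ramificationIdx_pos P
    have hαo := ord_sq_root P hα
    rw [horda, mul_one] at hαo
    have hb := hβord P (by rw [hπe]; omega)
    rw [hπe] at hb
    -- Here `ord π = ord α = e / 2` is divisible by `3`, so `6 ∣ e`, while `e ≤ 6`.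
    have h3 := hdvd _ _ hb
    have hef := ramificationIdx_mul_inertiaDeg_le P
    have hf0 := inertiaDeg_pos P
    have he : P.asIdeal.ramificationIdx k⟦X⟧ ≤ 6 := by nlinarith
    have he6 : P.asIdeal.ramificationIdx k⟦X⟧ = 6 := by omega
    have hα3 : ord P α = 3 := by omega
    rw [hα3] at hb
    exact ⟨by omega, he6, hα3⟩

theorem exists_eq_mul_zpow {c : k⸨X⸩} {n : ℤ}
    (h : c ≠ 0 → n ≤ ord (PowerSeries.idealX k) c) :
    ∃ r : k⟦X⟧, c = algebraMap k⟦X⟧ k⸨X⸩ r * (algebraMap k⟦X⟧ k⸨X⸩ PowerSeries.X) ^ n := by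
  rcases eq_or_ne c 0 with rfl | hc
  · exact ⟨0, by simp⟩
  have hX : algebraMap k⟦X⟧ k⸨X⸩ PowerSeries.X ≠ 0 := by simp
  obtain ⟨r, hr⟩ := exists_algebraMap_of_ord_nonneg
    (c := c * (algebraMap k⟦X⟧ k⸨X⸩ PowerSeries.X) ^ (-n)) (by
      rw [ord_mul _ hc (zpow_ne_zero _ hX), ord_zpow, ord_idealX_X]
      have := h hc
      omega)
  refine ⟨r, ?_⟩
  rw [hr, mul_assoc, ← zpow_add₀ hX, neg_add_cancel, zpow_zero, mul_one]

/-- This adjunction form characterizes the ceiling by integer inequalities alone, which is how `n₁`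
and `n₂` are used. -/
theorem ceil_div_le_iff {x : ℤ} {e : ℕ} (he : 0 < e) (m : ℤ) :
    ⌈(x : ℚ) / e⌉ ≤ m ↔ x ≤ e * m := by
  have he' : (0 : ℚ) < e := by exact_mod_cast he
  rw [Int.ceil_le, div_le_iff₀ he', mul_comm]
  exact_mod_cast Iff.rfl

/-- The integral anti-invariant elements of `L` are spanned by `α`, `t ^ n₁ β`, `t ^ n₂ α β ^ 2`. -/
theorem exists_of_integral_anti_invariant {α β : L} {j : ℕ}
    (hj : ¬ 3 ∣ j) {e : ℕ} (hβ0 : β ≠ 0) (hα0 : α ≠ 0)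
    (P : HeightOneSpectrum (integralClosure k⟦X⟧ L))
    (hβ : ord P β = -j) (he : P.asIdeal.ramificationIdx k⟦X⟧ = e)
    (heα : e = 3 ∧ ord P α = 0 ∨ e = 6 ∧ ord P α = 3) {n₁ n₂ : ℤ}
    (hn₁ : ∀ m, n₁ ≤ m ↔ -ord P β ≤ e * m)
    (hn₂ : ∀ m, n₂ ≤ m ↔ -2 * ord P β - ord P α ≤ e * m) {y : L} (hy : IsIntegral k⟦X⟧ y)
    {c₀ c₁ c₂ : k⸨X⸩} (hc : y = algebraMap k⸨X⸩ L c₀ * α + algebraMap k⸨X⸩ L c₁ * β +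
      algebraMap k⸨X⸩ L c₂ * (α * β ^ 2)) :
    ∃ r₀ r₁ r₂ : k⟦X⟧, y = algebraMap k⟦X⟧ L r₀ * α +
      algebraMap k⟦X⟧ L r₁ * (algebraMap k⟦X⟧ L PowerSeries.X ^ n₁ * β) +
      algebraMap k⟦X⟧ L r₂ * (algebraMap k⟦X⟧ L PowerSeries.X ^ n₂ * (α * β ^ 2)) := by
  have hne : ∀ {c : k⸨X⸩} {z : L}, algebraMap k⸨X⸩ L c * z ≠ 0 → algebraMap k⸨X⸩ L c ≠ 0 :=
    fun h => left_ne_zero_of_mul h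
  have hord : ∀ (c : k⸨X⸩) {z : L}, z ≠ 0 → algebraMap k⸨X⸩ L c ≠ 0 →
      ord P (algebraMap k⸨X⸩ L c * z) = e * ord (PowerSeries.idealX k) c + ord P z := by
    intro c z hz hc0
    rw [ord_mul P hc0 hz, ord_algebraMap, he]
  have hβ2 : ord P (α * β ^ 2) = ord P α + 2 * ord P β := by
    rw [ord_mul P hα0 (pow_ne_zero 2 hβ0), ord_pow]; norm_num
  have hαβ0 : α * β ^ 2 ≠ 0 := mul_ne_zero hα0 (pow_ne_zero 2 hβ0)
  have hint := (isIntegral_iff_forall_ord y).mp hy P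
  rw [hc] at hint
  -- Since `3` divides both `e` and `ord α`, the three orders are `0`, `-j`, `-2j` modulo `3`,
  -- pairwise distinct because `3 ∤ j`.
  obtain ⟨h0, h1, h2⟩ := ord_nonneg_of_add_add P
    (fun h h' => by
      rw [hord _ hα0 (hne h), hord _ hβ0 (hne h')]
      rcases heα with ⟨rfl, h''⟩ | ⟨rfl, h''⟩ <;> rw [h'', hβ] <;> push_cast <;> omega)
    (fun h h' => by
      rw [hord _ hβ0 (hne h), hord _ hαβ0 (hne h'), hβ2]
      rcases heα with ⟨rfl, h''⟩ | ⟨rfl, h''⟩ <;> rw [h'', hβ] <;> push_cast <;> omega)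
    (fun h h' => by
      rw [hord _ hα0 (hne h), hord _ hαβ0 (hne h'), hβ2]
      rcases heα with ⟨rfl, h''⟩ | ⟨rfl, h''⟩ <;> rw [h'', hβ] <;> push_cast <;> omega) hint
  have hne' : ∀ {c : k⸨X⸩}, c ≠ 0 → algebraMap k⸨X⸩ L c ≠ 0 := fun h => (map_ne_zero _).mpr h
  -- Exponent `0` suffices for `α`: as `0 ≤ ord α < e`, integrality of `c₀ α` already forces `v(c₀)
  -- ≥ 0`.
  obtain ⟨r₀, hr₀⟩ := exists_eq_mul_zpow (c := c₀) (n := 0) fun h => by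
    rw [hord _ hα0 (hne' h)] at h0
    rcases heα with ⟨rfl, h''⟩ | ⟨rfl, h''⟩ <;> rw [h''] at h0 <;> push_cast at h0 <;> omega
  obtain ⟨r₁, hr₁⟩ := exists_eq_mul_zpow (c := c₁) (n := n₁) fun h => by
    rw [hord _ hβ0 (hne' h)] at h1
    rw [hn₁]; omega
  obtain ⟨r₂, hr₂⟩ := exists_eq_mul_zpow (c := c₂) (n := n₂) fun h => by
    rw [hord _ hαβ0 (hne' h), hβ2] at h2
    rw [hn₂]; omega
  refine ⟨r₀, r₁, r₂, ?_⟩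
  simp only [IsScalarTower.algebraMap_apply k⟦X⟧ k⸨X⸩ L]
  rw [hc, hr₀, hr₁, hr₂]
  simp only [zpow_zero, mul_one, map_mul, map_zpow₀]
  ring

theorem isIntegral_of_ord_nonneg_generator {n : ℤ} {z : L} (hz : z ≠ 0)
    (h : ∀ P : HeightOneSpectrum (integralClosure k⟦X⟧ L),
      0 ≤ P.asIdeal.ramificationIdx k⟦X⟧ * n + ord P z) :
    IsIntegral k⟦X⟧ (algebraMap k⟦X⟧ L PowerSeries.X ^ n * z) := by
  rw [isIntegral_iff_forall_ord]
  intro P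
  have hX : algebraMap k⟦X⟧ L PowerSeries.X ≠ 0 := by
    rw [IsScalarTower.algebraMap_apply k⟦X⟧ k⸨X⸩ L]
    exact (map_ne_zero _).mpr (by simp)
  rw [ord_mul P (zpow_ne_zero _ hX) hz, ord_zpow,
    IsScalarTower.algebraMap_apply k⟦X⟧ k⸨X⸩ L, ord_algebraMap, ord_idealX_X]
  have := h P
  linarith

end ArtinSchreierExtension

/-! ### Relations of `S`, `T` and their action on coordinates. -/

section SymmetricGroup

variable (k : Type*) [Field k]

theorem matS_mul_matS_mul_matS : matS k * matS k * matS k = 1 := by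
  refine Subtype.ext ?_
  simp only [Matrix.SpecialLinearGroup.coe_mul, Matrix.SpecialLinearGroup.coe_one]
  ext i j
  fin_cases i <;> fin_cases j <;> simp [matS, Matrix.mul_apply, Fin.sum_univ_three]

theorem matT_mul_matT : matT k * matT k = 1 := by
  refine Subtype.ext ?_
  simp only [Matrix.SpecialLinearGroup.coe_mul, Matrix.SpecialLinearGroup.coe_one]
  ext i j
  fin_cases i <;> fin_cases j <;> simp [matT, Matrix.mul_apply, Fin.sum_univ_three]

theorem matS_mul_matT : matS k * matT k = matT k * (matS k * matS k) := by
  refine Subtype.ext ?_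
  simp only [Matrix.SpecialLinearGroup.coe_mul]
  ext i j
  fin_cases i <;> fin_cases j <;> simp [matS, matT, Matrix.mul_apply, Fin.sum_univ_three]

theorem vecMul_matS (m : Fin 3 → k⟦X⟧) :
    m ᵥ* ((matS k).1.map (PowerSeries.C (R := k))) = ![m 2, m 0, m 1] := by
  ext1 i
  fin_cases i <;> simp [matS, Matrix.vecMul, dotProduct, Fin.sum_univ_three]

theorem vecMul_matT (m : Fin 3 → k⟦X⟧) :
    m ᵥ* ((matT k).1.map (PowerSeries.C (R := k))) = ![-m 2, -m 1, -m 0] := by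
  ext1 i
  fin_cases i <;> simp [matT, Matrix.vecMul, dotProduct, Fin.sum_univ_three]

theorem det_naturalRep (G : Subgroup (Matrix.SpecialLinearGroup (Fin 3) k)) (g : G) :
    (naturalRep G g).det = 1 := by
  have := RingHom.map_det (PowerSeries.C (R := k)) (g : Matrix.SpecialLinearGroup (Fin 3) k).1
  rw [(g : Matrix.SpecialLinearGroup (Fin 3) k).2, map_one] at this
  exact this.symm

end SymmetricGroup

/-! ### Maps built from the orbit of one element. -/

section Equivariant

variable {k : Type*} [Field k] {L : Type*} [Field L] [Algebra k⸨X⸩ L]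
    [Algebra k⟦X⟧ L]

/-- The linear map on the coordinates determined by the image `y` of the middle coordinate and an
automorphism `σ`. -/
noncomputable def orbitMap (σ : L →ₐ[k⸨X⸩] L) (y : L) : (Fin 3 → k⟦X⟧) →ₗ[k⟦X⟧] L :=
  (LinearMap.proj 0).smulRight (σ (σ y)) + (LinearMap.proj 1).smulRight y +
    (LinearMap.proj 2).smulRight (σ y)

theorem orbitMap_apply (σ : L →ₐ[k⸨X⸩] L) (y : L) (m : Fin 3 → k⟦X⟧) :
    orbitMap σ y m = m 0 • σ (σ y) + m 1 • y + m 2 • σ y := rfl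

/-- Up to the factor `α² t₁ t₂` this is the Vandermonde determinant of `1, β, β²` at the points `β +
2`, `β`, `β + 1`, which equals `2 = -1`. -/
theorem det_orbitMap [CharP k 3] (σ : L →ₐ[k⸨X⸩] L) {α β t₁ t₂ : L} (hα : σ α = α)
    (hβ : σ β = β + 1) (ht₁ : σ t₁ = t₁) (ht₂ : σ t₂ = t₂) :
    (Matrix.of fun i j : Fin 3 => orbitMap (k := k) σ
      ((![α, t₁ * β, t₂ * (α * β ^ 2)] : Fin 3 → L) i) (Pi.single j 1)).det =
      -(α ^ 2 * (t₁ * t₂)) := by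
  have h3 : (3 : L) = 0 := three_eq_zero k
  simp only [Matrix.det_fin_three, Matrix.of_apply, orbitMap_apply]
  simp [hα, hβ, ht₁, ht₂]
  linear_combination (α ^ 2 * (t₁ * t₂)) * h3

theorem orbitMap_add (σ : L →ₐ[k⸨X⸩] L) (y z : L) :
    orbitMap σ (y + z) = orbitMap σ y + orbitMap σ z := by
  refine LinearMap.ext fun m => ?_
  simp only [LinearMap.add_apply, orbitMap_apply, map_add, smul_add]
  abel

variable [IsScalarTower k⟦X⟧ k⸨X⸩ L]

theorem algHom_smul (σ : L →ₐ[k⸨X⸩] L) (r : k⟦X⟧) (x : L) : σ (r • x) = r • σ x :=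
  map_smul (σ.restrictScalars k⟦X⟧) r x

theorem orbitMap_smul (σ : L →ₐ[k⸨X⸩] L) (r : k⟦X⟧) (y : L) :
    orbitMap σ (r • y) = r • orbitMap σ y := by
  refine LinearMap.ext fun m => ?_
  simp only [LinearMap.smul_apply, orbitMap_apply, algHom_smul, smul_add, smul_comm r]

theorem isIntegral_orbitMap (σ : L →ₐ[k⸨X⸩] L) {y : L} (hy : IsIntegral k⟦X⟧ y)
    (m : Fin 3 → k⟦X⟧) : IsIntegral k⟦X⟧ (orbitMap σ y m) := by
  have hσ : ∀ {x : L}, IsIntegral k⟦X⟧ x → IsIntegral k⟦X⟧ (σ x) := fun h =>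
    h.map (σ.restrictScalars k⟦X⟧)
  rw [orbitMap_apply]
  exact (((hσ (hσ hy)).smul _).add (hy.smul _)).add ((hσ hy).smul _)

end Equivariant

/-! ### Equivariant maps for the stabilizer generated by `S` and `T`. -/

section Stabilizer

variable {k : Type*} [Field k] {G : Subgroup (Matrix.SpecialLinearGroup (Fin 3) k)}
  {A : Type*} [CommRing A] [Algebra k⸨X⸩ A]
  [MulSemiringAction Gᵐᵒᵖ A] {L : Type*} [Field L] [Algebra k⸨X⸩ L]

theorem six_le_card [Finite G] (pr : A →ₐ[k⸨X⸩] L) {s t : componentStabilizer (G := G) pr}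
    (hs : ((s : G) : Matrix.SpecialLinearGroup (Fin 3) k) = matS k)
    (ht : ((t : G) : Matrix.SpecialLinearGroup (Fin 3) k) = matT k) (hs1 : s ≠ 1) (ht1 : t ≠ 1) :
    6 ≤ Nat.card (componentStabilizer (G := G) pr) := by
  have hs3 : s ^ 3 = 1 := Subtype.ext (Subtype.ext (by
    simpa [hs, pow_succ] using matS_mul_matS_mul_matS k))
  have ht2 : t ^ 2 = 1 := Subtype.ext (Subtype.ext (by
    simpa [ht, pow_succ] using matT_mul_matT k))
  have : Fact (Nat.Prime 3) := ⟨Nat.prime_three⟩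
  have h3 := orderOf_dvd_natCard s
  have h2 := orderOf_dvd_natCard t
  rw [orderOf_eq_prime hs3 hs1] at h3
  rw [orderOf_eq_prime ht2 ht1] at h2
  have : 0 < Nat.card (componentStabilizer (G := G) pr) := Nat.card_pos
  omega

variable [SMulCommClass Gᵐᵒᵖ k⸨X⸩ A]

theorem act_s_act_t (pr : A →ₐ[k⸨X⸩] L) (hpr : Function.Surjective pr)
    {s t : componentStabilizer (G := G) pr}
    (hs : ((s : G) : Matrix.SpecialLinearGroup (Fin 3) k) = matS k)
    (ht : ((t : G) : Matrix.SpecialLinearGroup (Fin 3) k) = matT k) (y : L) :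
    componentAct pr hpr t (componentAct pr hpr s y) =
      componentAct pr hpr s (componentAct pr hpr s (componentAct pr hpr t y)) := by
  have h : s * t = t * (s * s) := Subtype.ext (Subtype.ext (by
    simpa [hs, ht] using matS_mul_matT k))
  rw [← componentAct_mul, h, componentAct_mul, componentAct_mul]

theorem act_s_cubed (pr : A →ₐ[k⸨X⸩] L) (hpr : Function.Surjective pr)
    {s : componentStabilizer (G := G) pr}
    (hs : ((s : G) : Matrix.SpecialLinearGroup (Fin 3) k) = matS k) (y : L) :
    componentAct pr hpr s (componentAct pr hpr s (componentAct pr hpr s y)) = y := by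
  have hs3 : s * s * s = 1 := Subtype.ext (Subtype.ext (by
    simpa [hs] using matS_mul_matS_mul_matS k))
  rw [← componentAct_mul, ← componentAct_mul, ← mul_assoc, hs3, componentAct_one]

variable [Algebra k⟦X⟧ L] [IsScalarTower k⟦X⟧ k⸨X⸩ L]

/-- It suffices to check the generators: `S` cycles `y, σ y, σ² y` because `σ³ = 1`, and `T` negates
`y` and swaps the other two up to sign, because `S T = T S²`. -/
theorem orbitMap_equivariant (pr : A →ₐ[k⸨X⸩] L) (hpr : Function.Surjective pr)
    {s t : componentStabilizer (G := G) pr}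
    (hs : ((s : G) : Matrix.SpecialLinearGroup (Fin 3) k) = matS k)
    (ht : ((t : G) : Matrix.SpecialLinearGroup (Fin 3) k) = matT k)
    (hst : Subgroup.closure {s, t} = ⊤) {y : L} (hy : componentAct pr hpr t y = -y)
    (h : componentStabilizer (G := G) pr) (m : Fin 3 → k⟦X⟧) :
    orbitMap (componentAct pr hpr s) y (m ᵥ* naturalRep G h) =
      componentAct pr hpr h (orbitMap (componentAct pr hpr s) y m) := by
  have hmem : h ∈ Subgroup.closure {s, t} := by rw [hst]; trivial
  induction hmem using Subgroup.closure_induction generalizing m with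
  | mem x hx =>
    rcases hx with rfl | rfl
    · have : naturalRep G (x : G) = (matS k).1.map (PowerSeries.C (R := k)) := by
        rw [← hs]; rfl
      rw [this, vecMul_matS, orbitMap_apply, orbitMap_apply]
      simp only [map_add, algHom_smul, act_s_cubed pr hpr hs]
      simp
      abel
    · have : naturalRep G (x : G) = (matT k).1.map (PowerSeries.C (R := k)) := by
        rw [← ht]; rfl
      have h1 := act_s_act_t pr hpr hs ht y
      have h2 := act_s_act_t pr hpr hs ht (componentAct pr hpr s y)
      rw [h1, act_s_cubed pr hpr hs] at h2
      rw [this, vecMul_matT, orbitMap_apply, orbitMap_apply]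
      simp only [map_add, algHom_smul, h1, h2, hy, map_neg]
      simp
      abel
  | one => simp [componentAct_one]
  | mul x z _ _ hx hz =>
    rw [Subgroup.coe_mul, map_mul, ← Matrix.vecMul_vecMul, hz, hx, componentAct_mul]
  | inv x _ hx =>
    have h1 := hx (m ᵥ* naturalRep G ((x⁻¹ : componentStabilizer (G := G) pr) : G))
    rw [Matrix.vecMul_vecMul, ← map_mul, ← Subgroup.coe_mul, inv_mul_cancel, Subgroup.coe_one,
      map_one, Matrix.vecMul_one] at h1
    rw [h1, ← componentAct_mul, mul_inv_cancel, componentAct_one]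

/-- An element of the tuning module is determined on the component by the image of the middle
coordinate, which is anti-invariant under `t`. -/
theorem tuningModule_eq_orbitMap [Algebra k⟦X⟧ A] [IsScalarTower k⟦X⟧ k⸨X⸩ A]
    (pr : A →ₐ[k⸨X⸩] L) (hpr : Function.Surjective pr)
    {s t : componentStabilizer (G := G) pr}
    (hs : ((s : G) : Matrix.SpecialLinearGroup (Fin 3) k) = matS k)
    (ht : ((t : G) : Matrix.SpecialLinearGroup (Fin 3) k) = matT k)
    {φ : (Fin 3 → k⟦X⟧) →ₗ[k⟦X⟧] integralClosure k⟦X⟧ A} (hφ : φ ∈ tuningModule A (naturalRep G)) :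
    componentAct pr hpr t (pr (φ (Pi.single 1 1) : A)) = -pr (φ (Pi.single 1 1) : A) ∧
    ∀ m, pr (φ m : A) = orbitMap (componentAct pr hpr s) (pr (φ (Pi.single 1 1) : A)) m := by
  have hS : ∀ m : Fin 3 → k⟦X⟧, pr (φ ![m 2, m 0, m 1] : A) =
      componentAct pr hpr s (pr (φ m : A)) := by
    intro m
    have h1 := hφ (s : G) m
    have : naturalRep G (s : G) = (matS k).1.map (PowerSeries.C (R := k)) := by
      rw [← hs]; rfl
    rw [this, vecMul_matS] at h1
    rw [h1, componentAct_apply]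
  have hT : ∀ m : Fin 3 → k⟦X⟧, pr (φ ![-m 2, -m 1, -m 0] : A) =
      componentAct pr hpr t (pr (φ m : A)) := by
    intro m
    have h1 := hφ (t : G) m
    have : naturalRep G (t : G) = (matT k).1.map (PowerSeries.C (R := k)) := by
      rw [← ht]; rfl
    rw [this, vecMul_matT] at h1
    rw [h1, componentAct_apply]
  constructor
  · rw [← hT]
    have : (![-(Pi.single 1 1 : Fin 3 → k⟦X⟧) 2, -(Pi.single 1 1 : Fin 3 → k⟦X⟧) 1,
        -(Pi.single 1 1 : Fin 3 → k⟦X⟧) 0] : Fin 3 → k⟦X⟧) = -Pi.single 1 1 := by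
      ext1 i
      fin_cases i <;> simp
    rw [this, map_neg]
    simp
  · have h2 : pr (φ (Pi.single 2 1) : A) =
        componentAct pr hpr s (pr (φ (Pi.single 1 1) : A)) := by
      rw [← hS]
      congr 3
      ext1 i
      fin_cases i <;> simp
    have h0 : pr (φ (Pi.single 0 1) : A) =
        componentAct pr hpr s (pr (φ (Pi.single 2 1) : A)) := by
      rw [← hS]
      congr 3
      ext1 i
      fin_cases i <;> simp
    intro m
    let f : (Fin 3 → k⟦X⟧) →ₗ[k⟦X⟧] L := (pr.toLinearMap.restrictScalars k⟦X⟧) ∘ₗ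
      (Subalgebra.toSubmodule (integralClosure k⟦X⟧ A)).subtype ∘ₗ φ
    have hf : f = orbitMap (componentAct pr hpr s) (pr (φ (Pi.single 1 1) : A)) := by
      refine LinearMap.pi_ext' fun i => LinearMap.ext_ring ?_
      change pr (φ (Pi.single i 1) : A) = orbitMap _ _ (Pi.single i 1)
      rw [orbitMap_apply]
      fin_cases i
      · simp [h0, h2]
      · simp
      · simp [h2]
    exact LinearMap.congr_fun hf m

end Stabilizer

end WildMcKay

/-! ### Assembly of the formula. -/

open WildMcKay in
theorem lemma4p8 {k : Type*} [Field k] [Finite k] [CharP k 3]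
    -- a subgroup `G` of `SL_3(k)` and a `G`-étale `K`-algebra `A`, where `K = k⸨X⸩`
    (G : Subgroup (Matrix.SpecialLinearGroup (Fin 3) k))
    {A : Type*} [CommRing A] [Algebra k⸨X⸩ A] [Algebra k⟦X⟧ A] [IsScalarTower k⟦X⟧ k⸨X⸩ A]
    [MulSemiringAction Gᵐᵒᵖ A] [SMulCommClass Gᵐᵒᵖ k⸨X⸩ A] (hA : IsGEtale k G A)
    -- a component `L` of `A`
    {L : Type*} [Field L] [Algebra k⸨X⸩ L] [Algebra k⟦X⟧ L] [IsScalarTower k⟦X⟧ k⸨X⸩ L]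
    [FiniteDimensional k⸨X⸩ L] [IsGalois k⸨X⸩ L]
    (pr : A →ₐ[k⸨X⸩] L) (hpr : Function.Surjective pr)
    -- the stabilizer of the component is generated by `S` and `T`
    (s t : componentStabilizer (G := G) pr)
    (hs : ((s : G) : Matrix.SpecialLinearGroup (Fin 3) k) = matS k)
    (ht : ((t : G) : Matrix.SpecialLinearGroup (Fin 3) k) = matT k)
    (hst : Subgroup.closure {s, t} = ⊤)
    -- `Q` is the fixed field of `S`
    (Q : IntermediateField k⸨X⸩ L) (hQ : ∀ x : L, x ∈ Q ↔ componentAct pr hpr s x = x)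
    -- `Q = K(α)` with `α² = μ` or `μ ^ i * t`
    (μ : kˣ) (hμ : ∀ x : kˣ, x ∈ Subgroup.zpowers μ)
    (a : k⸨X⸩)
    (ha : a = HahnSeries.C (μ : k) ∨ ∃ i : ℕ, i ≤ 1 ∧
      a = HahnSeries.C ((μ : k) ^ i) * algebraMap k⟦X⟧ k⸨X⸩ PowerSeries.X)
    (α : L) (hα : α ^ 2 = algebraMap k⸨X⸩ L a)
    (hαQ : k⸨X⸩⟮α⟯ = Q) (hαT : componentAct pr hpr t α = -α)
    -- `L = Q(β)` with `β` a normalized Artin-Schreier generator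
    (π : integralClosure k⟦X⟧ Q) (hπ : Irreducible π)
    (lam : L) (hlam : lam ∈ residueConstants Q)
    (hlam' : ∀ κ ∈ residueConstants Q, κ ^ 3 - κ ≠ lam)
    (β : L) (hβ : β ^ 3 - β ∈ artinSchreierReps Q lam ((π : Q) : L))
    (hβQ : Q⟮β⟯ = ⊤)
    (hβS : componentAct pr hpr s β = β + 1) (hβT : componentAct pr hpr t β = -β)
    -- the (unique) nonzero prime of the integers of `L`
    (P : IsDedekindDomain.HeightOneSpectrum (integralClosure k⟦X⟧ L)) :
    P.asIdeal.ramificationIdx k⟦X⟧ = (open Classical in if a = HahnSeries.C (μ : k) then 3 else 6) ∧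
    tuningColength A (naturalRep G) ≠ ⊤ ∧
    vFunction A (naturalRep G) =
      ((ord (PowerSeries.idealX k) a
        + ⌈(-(ord P β) : ℚ) / P.asIdeal.ramificationIdx k⟦X⟧⌉
        + ⌈(-2 * (ord P β) - (ord P α) : ℚ) / P.asIdeal.ramificationIdx k⟦X⟧⌉ : ℤ) : ℚ) := by
  have hGfin : Finite G := by
    have : Finite (Matrix.SpecialLinearGroup (Fin 3) k) :=
      Finite.of_injective (fun g => g.1) Subtype.val_injective
    infer_instance
  set σ := componentAct pr hpr s with hσ
  set τ := componentAct pr hpr t with hτ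
  have hμns := not_isSquare_of_generator hμ
  have ha' : a = HahnSeries.C (μ : k) ∨ ∃ c : k, c ≠ 0 ∧
      a = HahnSeries.C c * algebraMap k⟦X⟧ k⸨X⸩ PowerSeries.X :=
    ha.imp_right fun ⟨i, _, h⟩ => ⟨(μ : k) ^ i, pow_ne_zero _ μ.ne_zero, h⟩
  have ha0 : a ≠ 0 := by
    rcases ha' with rfl | ⟨c, hc, rfl⟩
    · exact (map_ne_zero _).mpr μ.ne_zero
    · exact mul_ne_zero ((map_ne_zero _).mpr hc) (by simp)
  have hα0 : α ≠ 0 := by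
    rintro rfl
    rw [zero_pow two_ne_zero] at hα
    exact (map_ne_zero _).mpr ha0 hα.symm
  have hασ : σ α = α := (hQ α).mp (by
    rw [← hαQ]; exact IntermediateField.mem_adjoin_simple_self _ _)
  have h3 : (3 : L) = 0 := three_eq_zero k
  -- In characteristic `3`, `z³ - z` is unchanged by `z ↦ z + 1`.
  have hcQ : β ^ 3 - β ∈ Q := by
    rw [hQ]
    simp only [map_sub, map_pow, hβS]
    linear_combination (β ^ 2 + β) * h3
  have hβ3 : β ^ 3 = β + algebraMap Q L ⟨β ^ 3 - β, hcQ⟩ := by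
    change _ = β + (β ^ 3 - β); ring
  have hL6 : Module.finrank k⸨X⸩ L ≤ 6 := finrank_le_of_generators Q hα hαQ hβ3 hβQ
  obtain ⟨j, hj3, hdata⟩ := exists_ramification_data hμns ha' hα σ τ hαT Q hαQ hπ hlam hlam' hβ
    hβS hβT hL6 P
  have hs1 : s ≠ 1 := by
    rintro rfl
    rw [hσ, componentAct_one] at hβS
    exact one_ne_zero (left_eq_add.mp hβS)
  have ht1 : t ≠ 1 := by
    rintro rfl
    rw [hτ, componentAct_one] at hαT
    exact hα0 (by linear_combination α * h3 - hαT)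
  -- `s` and `t` act nontrivially on `β` and `α`, so they have orders `3` and `2` and the stabilizer
  -- has at least `6` elements; this gives the degree bound needed for the decomposition of `A`.
  have hcard : Module.finrank k⸨X⸩ L ≤ Nat.card (componentStabilizer (G := G) pr) :=
    hL6.trans (six_le_card pr hs ht hs1 ht1)
  have hβ0 : β ≠ 0 := by
    rintro rfl
    rw [map_zero, zero_add] at hβS
    exact zero_ne_one hβS
  -- uniform description of the ramification
  obtain ⟨e, he, hord, hP⟩ : ∃ e : ℕ, 0 < e ∧
      (e = 3 ∧ ord (PowerSeries.idealX k) a = 0 ∧ ord P α = 0 ∧ a = HahnSeries.C (μ : k) ∨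
        e = 6 ∧ ord (PowerSeries.idealX k) a = 1 ∧ ord P α = 3 ∧ a ≠ HahnSeries.C (μ : k)) ∧
      ∀ P' : IsDedekindDomain.HeightOneSpectrum (integralClosure k⟦X⟧ L),
        ord P' β = -j ∧ P'.asIdeal.ramificationIdx k⟦X⟧ = e ∧ ord P' α = ord P α := by
    rcases hdata with ⟨h1, h2, h⟩ | ⟨h1, h2, h⟩
    · exact ⟨3, by norm_num, Or.inl ⟨rfl, h2, (h P).2.2, h1⟩,
        fun P' => ⟨(h P').1, (h P').2.1, by rw [(h P').2.2, (h P).2.2]⟩⟩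
    · exact ⟨6, by norm_num, Or.inr ⟨rfl, h2, (h P).2.2, h1⟩,
        fun P' => ⟨(h P').1, (h P').2.1, by rw [(h P').2.2, (h P).2.2]⟩⟩
  have heα : e = 3 ∧ ord P α = 0 ∨ e = 6 ∧ ord P α = 3 :=
    hord.imp (fun h => ⟨h.1, h.2.2.1⟩) fun h => ⟨h.1, h.2.2.1⟩
  have hn₁ := ceil_div_le_iff (x := -ord P β) he
  have hn₂ := ceil_div_le_iff (x := -2 * ord P β - ord P α) he
  have hidx : P.asIdeal.ramificationIdx k⟦X⟧ = e := (hP P).2.1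
  rw [hidx]
  push_cast at hn₁ hn₂
  set n₁ := ⌈(-(ord P β) : ℚ) / e⌉ with hn₁_def
  set n₂ := ⌈(-2 * (ord P β) - (ord P α) : ℚ) / e⌉ with hn₂_def
  have hβP : ord P β = -j := (hP P).1
  have hαβ0 : α * β ^ 2 ≠ 0 := mul_ne_zero hα0 (pow_ne_zero 2 hβ0)
  -- the generators of the tuning module
  let X' : L := algebraMap k⟦X⟧ L PowerSeries.X
  have hX' : X' = algebraMap k⸨X⸩ L (algebraMap k⟦X⟧ k⸨X⸩ PowerSeries.X) :=
    IsScalarTower.algebraMap_apply _ _ _ _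
  have hfixX : ∀ (f : L →ₐ[k⸨X⸩] L) (n : ℤ), f (X' ^ n) = X' ^ n := fun f n => by
    rw [map_zpow₀, hX', AlgHom.commutes]
  let y : Fin 3 → L := ![α, X' ^ n₁ * β, X' ^ n₂ * (α * β ^ 2)]
  have hyint : ∀ i, IsIntegral k⟦X⟧ (y i) := by
    intro i
    fin_cases i
    · change IsIntegral k⟦X⟧ α
      have h := isIntegral_of_ord_nonneg_generator (n := 0) hα0 fun P' => by
        rw [(hP P').2.2]; omega
      simpa using h
    · exact isIntegral_of_ord_nonneg_generator hβ0 fun P' => by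
        have := (hn₁ n₁).mp le_rfl
        rw [(hP P').1, (hP P').2.1]; omega
    · exact isIntegral_of_ord_nonneg_generator hαβ0 fun P' => by
        have := (hn₂ n₂).mp le_rfl
        rw [ord_mul P' hα0 (pow_ne_zero 2 hβ0), ord_pow, (hP P').1, (hP P').2.1, (hP P').2.2]
        push_cast; omega
  have hyτ : ∀ i, τ (y i) = -y i := by
    intro i
    fin_cases i
    · exact hαT
    · change τ (X' ^ n₁ * β) = -(X' ^ n₁ * β)
      rw [map_mul, hfixX, hβT]; ring
    · change τ (X' ^ n₂ * (α * β ^ 2)) = -(X' ^ n₂ * (α * β ^ 2))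
      rw [map_mul, hfixX, map_mul, map_pow, hβT, hαT]; ring
  have hlift : ∀ i, ∃ φ ∈ tuningModule A (naturalRep G), ∀ m, pr (φ m : A) = orbitMap σ (y i) m :=
    fun i => exists_mem_tuningModule hA pr hpr hcard (naturalRep G) (orbitMap σ (y i))
      (orbitMap_equivariant pr hpr hs ht hst (hyτ i)) (isIntegral_orbitMap σ (hyint i))
  choose φ hφ hφy using hlift
  have hspan : tuningModule A (naturalRep G) = Submodule.span k⟦X⟧ (Set.range φ) := by
    apply le_antisymm
    · intro ψ hψ
      obtain ⟨hz, hψz⟩ := tuningModule_eq_orbitMap pr hpr hs ht hψ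
      have hzint : IsIntegral k⟦X⟧ (pr (ψ (Pi.single 1 1) : A)) :=
        (ψ (Pi.single 1 1)).2.map (pr.restrictScalars k⟦X⟧)
      have : CharP k⸨X⸩ 3 :=
        charP_of_injective_ringHom (HahnSeries.C (Γ := ℤ) (R := k)).injective 3
      obtain ⟨c₀, c₁, c₂, hc⟩ :=
        exists_of_anti_invariant Q hα hαQ hβ3 hβQ τ hαT hβT hz
      obtain ⟨r₀, r₁, r₂, hr⟩ := exists_of_integral_anti_invariant hj3 hβ0 hα0 P hβP hidx heα
        hn₁ hn₂ hzint hc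
      have hψ' : ψ = r₀ • φ 0 + r₁ • φ 1 + r₂ • φ 2 := by
        refine tuningModule_ext hA pr (naturalRep G) hψ
          (add_mem (add_mem (Submodule.smul_mem _ _ (hφ 0)) (Submodule.smul_mem _ _ (hφ 1)))
            (Submodule.smul_mem _ _ (hφ 2))) fun m => ?_
        have hr' : pr (ψ (Pi.single 1 1) : A) = r₀ • y 0 + r₁ • y 1 + r₂ • y 2 := by
          rw [hr]; simp only [Algebra.smul_def]; rfl
        rw [hψz, hr']
        simp only [orbitMap_add, orbitMap_smul, LinearMap.add_apply, LinearMap.smul_apply]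
        have hsm : ∀ (r : k⟦X⟧) (b : A), pr (r • b) = r • pr b := fun r b =>
          map_smul (pr.restrictScalars k⟦X⟧) r b
        simp [hsm, hφy, ← hσ]
      rw [hψ']
      exact add_mem (add_mem (Submodule.smul_mem _ _ (Submodule.subset_span ⟨0, rfl⟩))
        (Submodule.smul_mem _ _ (Submodule.subset_span ⟨1, rfl⟩)))
        (Submodule.smul_mem _ _ (Submodule.subset_span ⟨2, rfl⟩))
    · rw [Submodule.span_le]
      rintro _ ⟨i, rfl⟩
      exact hφ i
  -- the determinant
  have hXK : algebraMap k⟦X⟧ k⸨X⸩ PowerSeries.X ≠ 0 := by simp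
  let d : k⸨X⸩ := -(a * (algebraMap k⟦X⟧ k⸨X⸩ PowerSeries.X) ^ (n₁ + n₂))
  have hd0 : d ≠ 0 := neg_ne_zero.mpr (mul_ne_zero ha0 (zpow_ne_zero _ hXK))
  have hdord : ord (PowerSeries.idealX k) d = ord (PowerSeries.idealX k) a + n₁ + n₂ := by
    rw [ord_neg, ord_mul _ ha0 (zpow_ne_zero _ hXK), ord_zpow, ord_idealX_X]; ring
  -- The ceilings are nonnegative because `j ≥ 0` and `ord α < e`, so the determinant lies in
  -- `k⟦X⟧`.
  have hdnonneg : 0 ≤ ord (PowerSeries.idealX k) d := by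
    rw [hdord]
    have h1 := (hn₁ n₁).mp le_rfl
    have h2 := (hn₂ n₂).mp le_rfl
    rw [hβP] at h1 h2
    rcases hord with ⟨rfl, h4, h5, -⟩ | ⟨rfl, h4, h5, -⟩ <;> rw [h5] at h2 <;> rw [h4] <;>
      push_cast at h1 h2 <;> omega
  obtain ⟨r, hr⟩ := exists_algebraMap_of_ord_nonneg hdnonneg
  have hr0 : r ≠ 0 := by
    rintro rfl
    exact hd0 (by rw [← hr, map_zero])
  have hdet : (Matrix.of fun i j => pr (φ i (Pi.single j 1) : A)).det =
      algebraMap k⸨X⸩ L (algebraMap k⟦X⟧ k⸨X⸩ r) := by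
    simp only [hφy]
    rw [hr]
    refine (det_orbitMap σ hασ hβS (hfixX σ n₁) (hfixX σ n₂)).trans ?_
    simp only [d, map_neg, map_mul, map_zpow₀, ← hX', hα]
    rw [zpow_add₀ (by rw [hX']; exact (map_ne_zero _).mpr hXK)]
  have hlen := tuningColength_eq hA pr hpr hcard (naturalRep G) (det_naturalRep k G) φ hspan hr0 hdet
  obtain ⟨hrord, hrtop⟩ := ringOrd_eq_ord hr0
  refine ⟨?_, ?_, ?_⟩
  · rcases hord with ⟨rfl, -, -, h⟩ | ⟨rfl, -, -, h⟩
    · rw [if_pos h]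
    · rw [if_neg h]
  · rw [hlen]
    exact WithTop.mul_ne_top (ENat.natCast_ne_top _) hrtop
  · have hG : (Nat.card G : ℚ) ≠ 0 := by exact_mod_cast Nat.card_pos.ne'
    rw [vFunction, hlen, ENat.toNat_mul, ENat.toNat_natCast, Nat.cast_mul, mul_div_cancel_left₀ _ hG,
      ← hdord, ← hr, ← hrord]
    rfl
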